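/- Let $r\ge 0$ be an integer and let $\mathbf H_r(0)$ be the $0$-Hecke algebra, i.e. the unital associative $\mathbb C$-algebra generated by $\bar\pi_1,\dots,\bar\pi_{r-1}$ with relations $\bar\pi_i^2=-\bar\pi_i$, $\bar\pi_i\bar\pi_{i+1}\bar\pi_i=\bar\pi_{i+1}\bar\pi_i\bar\pi_{i+1}$, and $\bar\pi_i\bar\pi_j=\bar\pi_j\bar\pi_i$ for $|i-j|\ge 2$; put $\pi_i:=\bar\pi_i+1$. For a permutation $w\in\mathfrak S_r$ with reduced expression $w=s_{i_1}\cdots s_{i_p}$ put $\bar\pi_w:=\bar\pi_{i_1}\cdots\bar\pi_{i_p}$ and $\pi_w:=\pi_{i_1}\cdots\pi_{i_p}$, which do not depend on the reduced expression. For $S\subseteq[r-1]:=\{1,\dots,r-1\}$ let $w_0(S)$ be the longest element of the subgroup of $\mathfrak S_r$ generated by the simple transpositions $s_i=(i\ i{+}1)$, $i\in S$. Let $\Lambda^+(r)$ be the set of compositions $\alpha=(\alpha_1,\dots,\alpha_n)$ of $r$ into positive parts, let $\mathrm{set}(\alpha):=\{\alpha_1,\alpha_1+\alpha_2,\dots,\alpha_1+\cdots+\alpha_{n-1}\}\subseteq[r-1]$,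 let $\alpha^{\mathrm r}:=(\alpha_n,\dots,\alpha_1)$, and let $\alpha^{\mathrm c}$ be the composition of $r$ with $\mathrm{set}(\alpha^{\mathrm c})=[r-1]\setminus\mathrm{set}(\alpha)$. For $\alpha\in\Lambda^+(r)$ let $$R_\alpha:=\mathbf H_r(0)\,\bar\pi_{w_0(\mathrm{set}(\alpha))}\,\pi_{w_0([r-1]\setminus\mathrm{set}(\alpha))}$$ be the corresponding projective indecomposable left $\mathbf H_r(0)$-module, and let $d_{\alpha,\beta}:=\dim_{\mathbb C}\operatorname{Hom}_{\mathbf H_r(0)}(R_\alpha,R_\beta)$ for $\alpha,\beta\in\Lambda^+(r)$ be the entries of the Cartan matrix of $\mathbf H_r(0)$. Let $D_4\times\mathbb Z_2$, where $D_4$ is the dihedral group of order $8$, act on $\Lambda^+(r)^2$ so that a rotation of order $4$ generating the rotation subgroup of $D_4$ acts by $\eta\colon(\alpha,\beta)\mapsto(\beta^{\mathrm r},\alpha)$, a reflection in $D_4$ acts by $\mathsf{ex}\colon(\alpha,\beta)\mapsto(\beta,\alpha)$, and the generator of $\mathbb Z_2$ acts by $\mathsf c\colon(\alpha,\beta)\mapsto(\alpha^{\mathrm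 c},\beta^{\mathrm c})$. Then the Cartan matrix of $\mathbf H_r(0)$ is constant on each $D_4\times\mathbb Z_2$-orbit: if $(\alpha,\beta)$ and $(\alpha',\beta')$ in $\Lambda^+(r)^2$ lie in the same orbit, then $d_{\alpha,\beta}=d_{\alpha',\beta'}$. -/

import Mathlib

noncomputable section

namespace ZeroHecke

/-! ### Compositions

A (strong) composition of `r` is Mathlib's `Composition r`, and `α ↦ αʳ` is `Composition.reverse`.
The set `[r-1] = {1, …, r-1}` is represented by `Fin (r - 1)`, where `i : Fin (r - 1)` stands for
the integer `i + 1`. -/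

/-- The bijection `α ↦ set(α) = {α₁, α₁ + α₂, …, α₁ + ⋯ + α_{n-1}}` from compositions of `r`
to subsets of `[r-1]`; see `mem_setEquiv`. -/
def setEquiv (r : ℕ) : Composition r ≃ Finset (Fin (r - 1)) :=
  (compositionEquiv r).trans (compositionAsSetEquiv r)

theorem mem_setEquiv {r : ℕ} (α : Composition r) (i : Fin (r - 1)) :
    i ∈ setEquiv r α ↔ ∃ k ≤ α.length, (α.blocks.take k).sum = (i : ℕ) + 1 := by
  simp only [setEquiv, compositionEquiv, compositionAsSetEquiv, Equiv.trans_apply,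
    Equiv.coe_fn_mk, Set.mem_toFinset, Set.mem_ofPred_eq,
    Composition.toCompositionAsSet_boundaries, Composition.boundaries, Finset.mem_map,
    Finset.mem_univ, true_and, Composition.boundary, Composition.sizeUpTo,
    OrderEmbedding.coe_ofStrictMono, RelEmbedding.coe_toEmbedding, Fin.ext_iff, add_comm 1]
  constructor
  · rintro ⟨k, hk⟩
    exact ⟨k, by omega, hk⟩
  · rintro ⟨k, hk, h⟩
    exact ⟨⟨k, by omega⟩, h⟩

/-- The complement `αᶜ`: the composition with `set(αᶜ) = [r-1] \ set(α)`. -/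
def complement {r : ℕ} (α : Composition r) : Composition r :=
  (setEquiv r).symm (setEquiv r α)ᶜ

theorem setEquiv_complement {r : ℕ} (α : Composition r) :
    setEquiv r (complement α) = (setEquiv r α)ᶜ := by
  simp [complement]

theorem complement_complement {r : ℕ} (α : Composition r) : complement (complement α) = α := by
  simp [complement]

theorem rev_mem_setEquiv_reverse {r : ℕ} (α : Composition r) (i : Fin (r - 1)) :
    i.rev ∈ setEquiv r α.reverse ↔ i ∈ setEquiv r α := by
  have key : ∀ (β : Composition r) (j : Fin (r - 1)),
      j ∈ setEquiv r β → j.rev ∈ setEquiv r β.reverse := by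
    intro β j h
    rw [mem_setEquiv] at h ⊢
    obtain ⟨k, hk, h⟩ := h
    have hl : β.blocks.length = β.length := rfl
    have hs := β.blocks_sum
    have ht := List.sum_take_add_sum_drop β.blocks k
    refine ⟨β.length - k, ?_, ?_⟩
    · simp [Composition.reverse, Composition.length]
    · simp only [Composition.reverse, List.take_reverse, List.sum_reverse, hl, Fin.val_rev]
      rw [Nat.sub_sub_self hk]
      omega
  refine ⟨fun h => ?_, key α i⟩
  simpa using key _ _ h

theorem complement_reverse {r : ℕ} (α : Composition r) :
    complement α.reverse = (complement α).reverse := by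
  apply (setEquiv r).injective
  ext i
  obtain ⟨j, rfl⟩ := Fin.rev_surjective i
  rw [rev_mem_setEquiv_reverse, setEquiv_complement, setEquiv_complement, Finset.mem_compl,
    Finset.mem_compl, rev_mem_setEquiv_reverse]

/-! ### The symmetric group: reduced words and longest elements -/

/-- The simple transposition `(i, i+1)` of the symmetric group on `r` letters. -/
def simpleTransposition {r : ℕ} (i : Fin (r - 1)) : Equiv.Perm (Fin r) :=
  Equiv.swap ⟨i, by omega⟩ ⟨i + 1, by omega⟩

/-- `l` is (the list of indices of) a reduced expression of `w`. -/
def IsReducedWord {r : ℕ} (w : Equiv.Perm (Fin r)) (l : List (Fin (r - 1))) : Prop :=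
  (l.map simpleTransposition).prod = w ∧
    ∀ l' : List (Fin (r - 1)), (l'.map simpleTransposition).prod = w → l.length ≤ l'.length

theorem exists_word {r : ℕ} (w : Equiv.Perm (Fin r)) :
    ∃ l : List (Fin (r - 1)), (l.map simpleTransposition).prod = w := by
  cases r with
  | zero => exact ⟨[], Subsingleton.elim _ _⟩
  | succ n =>
    have hw : w ∈ Submonoid.closure
        (Set.range fun i : Fin n ↦ Equiv.swap i.castSucc i.succ) := by
      rw [Equiv.Perm.mclosure_swap_castSucc_succ]; trivial
    induction hw using Submonoid.closure_induction with
    | mem x hx =>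
      obtain ⟨i, rfl⟩ := hx
      exact ⟨[i], by simp [simpleTransposition]; rfl⟩
    | one => exact ⟨[], rfl⟩
    | mul x y _ _ hx hy =>
      obtain ⟨a, rfl⟩ := hx
      obtain ⟨b, rfl⟩ := hy
      exact ⟨a ++ b, by simp⟩

theorem exists_reducedWord {r : ℕ} (w : Equiv.Perm (Fin r)) :
    ∃ l : List (Fin (r - 1)), IsReducedWord w l := by
  obtain ⟨l, hl, hmin⟩ := (measure (List.length (α := Fin (r - 1)))).wf.has_min
    {l | (l.map simpleTransposition).prod = w} (exists_word w)
  exact ⟨l, hl, fun l' hl' => not_lt.mp (hmin l' hl')⟩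

/-- A chosen reduced expression of `w`. -/
def reducedWord {r : ℕ} (w : Equiv.Perm (Fin r)) : List (Fin (r - 1)) :=
  (exists_reducedWord w).choose

theorem isReducedWord_reducedWord {r : ℕ} (w : Equiv.Perm (Fin r)) :
    IsReducedWord w (reducedWord w) :=
  (exists_reducedWord w).choose_spec

/-- The length `ℓ(w)`: the length of a reduced expression of `w`. -/
def permLength {r : ℕ} (w : Equiv.Perm (Fin r)) : ℕ :=
  (reducedWord w).length

/-- The parabolic subgroup generated by the `s_i` with `i ∈ S`. -/
def parabolic {r : ℕ} (S : Finset (Fin (r - 1))) : Subgroup (Equiv.Perm (Fin r)) :=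
  Subgroup.closure (simpleTransposition '' (S : Set (Fin (r - 1))))

theorem exists_longest {r : ℕ} (S : Finset (Fin (r - 1))) :
    ∃ w ∈ parabolic S, ∀ u ∈ parabolic S, permLength u ≤ permLength w :=
  Set.exists_max_image (parabolic S : Set (Equiv.Perm (Fin r))) permLength
    (Set.toFinite _) ⟨1, one_mem _⟩

/-- `w₀(S)`, the longest element of the parabolic subgroup of `S`. -/
def longest {r : ℕ} (S : Finset (Fin (r - 1))) : Equiv.Perm (Fin r) :=
  (exists_longest S).choose

theorem longest_spec {r : ℕ} (S : Finset (Fin (r - 1))) :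
    longest S ∈ parabolic S ∧ ∀ u ∈ parabolic S, permLength u ≤ permLength (longest S) :=
  (exists_longest S).choose_spec

/-! ### The 0-Hecke algebra -/

/-- The defining relations of the 0-Hecke algebra in the generators `π̄_i`. -/
inductive Rel (r : ℕ) :
    FreeAlgebra ℂ (Fin (r - 1)) → FreeAlgebra ℂ (Fin (r - 1)) → Prop
  | quad (i : Fin (r - 1)) :
      Rel r (FreeAlgebra.ι ℂ i * FreeAlgebra.ι ℂ i) (-FreeAlgebra.ι ℂ i)
  | braid (i j : Fin (r - 1)) (h : (i : ℕ) + 1 = j) :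
      Rel r (FreeAlgebra.ι ℂ i * FreeAlgebra.ι ℂ j * FreeAlgebra.ι ℂ i)
        (FreeAlgebra.ι ℂ j * FreeAlgebra.ι ℂ i * FreeAlgebra.ι ℂ j)
  | comm (i j : Fin (r - 1)) (h : (i : ℕ) + 2 ≤ j ∨ (j : ℕ) + 2 ≤ i) :
      Rel r (FreeAlgebra.ι ℂ i * FreeAlgebra.ι ℂ j) (FreeAlgebra.ι ℂ j * FreeAlgebra.ι ℂ i)

/-- The 0-Hecke algebra `H_r(0)` over `ℂ`. -/
abbrev Hecke (r : ℕ) : Type := RingQuot (Rel r)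

/-- The generator `π̄_i`, with `π̄_i² = -π̄_i`. -/
def opi {r : ℕ} (i : Fin (r - 1)) : Hecke r :=
  RingQuot.mkAlgHom ℂ (Rel r) (FreeAlgebra.ι ℂ i)

/-- The generator `π_i = π̄_i + 1`. -/
def pi {r : ℕ} (i : Fin (r - 1)) : Hecke r := opi i + 1

/-- `π̄_w`, the product of the `π̄_i` along a reduced expression of `w`. -/
def opiPerm {r : ℕ} (w : Equiv.Perm (Fin r)) : Hecke r :=
  ((reducedWord w).map opi).prod

/-- `π_w`, the product of the `π_i` along a reduced expression of `w`. -/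
def piPerm {r : ℕ} (w : Equiv.Perm (Fin r)) : Hecke r :=
  ((reducedWord w).map pi).prod

/-- The projective indecomposable module
`R_α = H_r(0) π̄_{w₀(set(α))} π_{w₀([r-1] \ set(α))}`, a left ideal of `H_r(0)`. -/
def projIndec {r : ℕ} (α : Composition r) : Submodule (Hecke r) (Hecke r) :=
  Submodule.span (Hecke r)
    {opiPerm (longest (setEquiv r α)) * piPerm (longest (setEquiv r α)ᶜ)}

/-- The Cartan matrix of `H_r(0)`: `d_{α,β} = dim_ℂ Hom_{H_r(0)}(R_α, R_β)`. -/
def cartan (r : ℕ) : Matrix (Composition r) (Composition r) ℕ :=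
  Matrix.of fun α β => Module.finrank ℂ (projIndec α →ₗ[Hecke r] projIndec β)

/-! ### The action of `D₄ × ℤ₂` on pairs of compositions -/

/-- `ex (α, β) = (β, α)`. -/
def ex (r : ℕ) : Equiv.Perm (Composition r × Composition r) where
  toFun p := (p.2, p.1)
  invFun p := (p.2, p.1)
  left_inv _ := rfl
  right_inv _ := rfl

/-- `c (α, β) = (αᶜ, βᶜ)`. -/
def compl (r : ℕ) : Equiv.Perm (Composition r × Composition r) where
  toFun p := (complement p.1, complement p.2)
  invFun p := (complement p.1, complement p.2)
  left_inv p := by simp [complement_complement]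
  right_inv p := by simp [complement_complement]

/-- `η (α, β) = (βʳ, α)`. -/
def eta (r : ℕ) : Equiv.Perm (Composition r × Composition r) where
  toFun p := (p.2.reverse, p.1)
  invFun p := (p.2, p.1.reverse)
  left_inv p := by simp
  right_inv p := by simp

theorem ex_mul_ex (r : ℕ) : ex r * ex r = 1 := rfl

theorem compl_mul_compl (r : ℕ) : compl r * compl r = 1 := by
  ext1 p
  simp [compl, complement_complement]

theorem eta_pow_four (r : ℕ) : eta r ^ 4 = 1 := by
  ext1 p
  simp [eta, pow_succ]

theorem eta_mul_ex (r : ℕ) : eta r * ex r = ex r * (eta r)⁻¹ := by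
  ext1 p
  apply (ex r).injective
  simp [eta, ex, Equiv.Perm.inv_def]

theorem ex_commute_compl (r : ℕ) : Commute (ex r) (compl r) := rfl

theorem eta_commute_compl (r : ℕ) : Commute (eta r) (compl r) := by
  ext1 p
  simp [eta, compl, complement_reverse]

/-- The homomorphism from the dihedral group of order 8 with `r 1 ↦ η` and `sr 0 ↦ ex`. -/
def dihedralHom (r : ℕ) : DihedralGroup 4 →* Equiv.Perm (Composition r × Composition r) where
  toFun
    | .r i => eta r ^ i.val
    | .sr i => ex r * eta r ^ i.val
  map_one' := by
    change eta r ^ (0 : ZMod 4).val = 1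
    simp
  map_mul' := by
    have h4 := eta_pow_four r
    have hadd : ∀ i j : ZMod 4, eta r ^ (i + j).val = eta r ^ i.val * eta r ^ j.val := by
      intro i j
      rw [ZMod.val_add, ← pow_add, ← pow_eq_pow_mod _ h4]
    have hconj : ∀ n : ℕ, eta r ^ n * ex r = ex r * (eta r ^ n)⁻¹ := by
      intro n
      induction n with
      | zero => simp
      | succ n ih =>
        rw [pow_succ, mul_assoc, eta_mul_ex, ← mul_assoc, ih, mul_assoc, ← mul_inv_rev,
          ← pow_succ', pow_succ]
    have hsub : ∀ i j : ZMod 4, eta r ^ (i - j).val = (eta r ^ j.val)⁻¹ * eta r ^ i.val := by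
      intro i j
      rw [eq_inv_mul_iff_mul_eq, ← hadd, add_sub_cancel]
    rintro (i | i) (j | j)
    · exact hadd i j
    · change ex r * eta r ^ (j - i).val = eta r ^ i.val * (ex r * eta r ^ j.val)
      rw [hsub, ← mul_assoc, ← mul_assoc, hconj]
    · change ex r * eta r ^ (i + j).val = ex r * eta r ^ i.val * eta r ^ j.val
      rw [hadd, mul_assoc]
    · change eta r ^ (j - i).val = ex r * eta r ^ i.val * (ex r * eta r ^ j.val)
      rw [hsub, mul_assoc, ← mul_assoc (eta r ^ i.val), hconj, ← mul_assoc, ← mul_assoc,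
        ex_mul_ex, one_mul]

/-- The homomorphism from `ℤ₂` sending the generator to `c`. -/
def complHom (r : ℕ) :
    Multiplicative (ZMod 2) →* Equiv.Perm (Composition r × Composition r) where
  toFun k := compl r ^ k.toAdd.val
  map_one' := by simp
  map_mul' j k := by
    have h2 : compl r ^ 2 = 1 := by rw [pow_two, compl_mul_compl]
    rw [toAdd_mul, ZMod.val_add, ← pow_add, ← pow_eq_pow_mod _ h2]

theorem dihedralHom_commute_complHom (r : ℕ) (g : DihedralGroup 4)
    (k : Multiplicative (ZMod 2)) : Commute (dihedralHom r g) (complHom r k) := by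
  refine Commute.pow_right ?_ _
  rcases g with i | i
  · exact (eta_commute_compl r).pow_left _
  · exact (ex_commute_compl r).mul_left ((eta_commute_compl r).pow_left _)

/-- The homomorphism `D₄ × ℤ₂ → ⟨ex, c, η⟩`. -/
def actionHom (r : ℕ) : DihedralGroup 4 × Multiplicative (ZMod 2) →*
    Equiv.Perm (Composition r × Composition r) :=
  (dihedralHom r).noncommCoprod (complHom r) (dihedralHom_commute_complHom r)

/-- The action of `D₄ × ℤ₂` on pairs of compositions of `r`. -/
instance pairAction (r : ℕ) : MulAction (DihedralGroup 4 × Multiplicative (ZMod 2))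
    (Composition r × Composition r) :=
  MulAction.compHom _ (actionHom r)

theorem smul_rotation {r : ℕ} (α β : Composition r) :
    ((DihedralGroup.r 1, 1) : DihedralGroup 4 × Multiplicative (ZMod 2)) • (α, β)
      = (β.reverse, α) := by
  change (eta r ^ 1 * compl r ^ 0) (α, β) = _
  simp [eta]

theorem smul_reflection {r : ℕ} (α β : Composition r) :
    ((DihedralGroup.sr 0, 1) : DihedralGroup 4 × Multiplicative (ZMod 2)) • (α, β)
      = (β, α) := by
  change (ex r * eta r ^ 0 * compl r ^ 0) (α, β) = _
  simp [ex]

theorem smul_complement {r : ℕ} (α β : Composition r) :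
    ((1, Multiplicative.ofAdd 1) : DihedralGroup 4 × Multiplicative (ZMod 2)) • (α, β)
      = (complement α, complement β) := by
  change (eta r ^ 0 * compl r ^ 1) (α, β) = _
  simp [compl]

end ZeroHecke

end

/-! Write `gen S = opiLong S * piLong Sᶜ` for the generator of `R_α` with `S = set(α)`. The
generator need not be idempotent, but it is group invertible: `g = g²s` for some `s` commuting with
`g`. This is enough to identify `Hom(Aa, Ab)` with the corner `aAb` by `f ↦ f(a)`
(`finrank_hom_span`), so the Cartan matrix consists of dimensions of corners, and the theorem
reduces to three symmetries of these dimensions.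

Symmetry: for group invertible products the corners of `xy, x'y'` and of `yx, y'x'` have equal
dimension (`finrank_corner_swap`). The anti-automorphism fixing the `π̄_i` exchanges the two factors
of `gen S`, so `d_{α,β} = d_{β,α}`.

Complement: the automorphism `π̄_i ↦ -π_i` sends `gen Sᶜ` to a sign times `revGen S`, and the swap
brings `revGen` back to `gen`.

Rotation: the coefficient of `π̄_{w₀}` is a nondegenerate form `L` with `L(gh) = L(h ν(g))`, where
the Nakayama automorphism `ν` is `π̄_i ↦ π̄_{r-i}`. Pairing `aAb` with `bAν(a)` gives `d_{α,β} ≤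
d_{β,αʳ}`. Four iterations return to `(α, β)`, so equality holds.

Group invertibility rests on a leading term argument in the basis `π̄_w` (`mul_gen_eq_zero`): right
multiplication by `gen S` preserves, up to sign, the shortest terms whose descent set is exactly
`S`. The basis itself comes from the equality of length and inversion number and from Matsumoto's
theorem (`IsReducedWord.map_prod_eq`). -/

noncomputable section

namespace ZeroHecke

/-! ### Inversions and reduced words -/

section Perm

variable {r : ℕ}

/-- The position `i` as an element of `Fin r`. -/
def lo (i : Fin (r - 1)) : Fin r := ⟨i, by omega⟩

/-- The position `i + 1` as an element of `Fin r`. -/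
def hi (i : Fin (r - 1)) : Fin r := ⟨i + 1, by omega⟩

@[simp] theorem val_lo (i : Fin (r - 1)) : (lo i : ℕ) = i := rfl

@[simp] theorem val_hi (i : Fin (r - 1)) : (hi i : ℕ) = i + 1 := rfl

theorem lo_lt_hi (i : Fin (r - 1)) : lo i < hi i := by simp [Fin.lt_def]

theorem simpleTransposition_eq (i : Fin (r - 1)) :
    simpleTransposition i = Equiv.swap (lo i) (hi i) := rfl

@[simp] theorem simpleTransposition_lo (i : Fin (r - 1)) :
    simpleTransposition i (lo i) = hi i := by
  simp [simpleTransposition_eq]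

@[simp] theorem simpleTransposition_hi (i : Fin (r - 1)) :
    simpleTransposition i (hi i) = lo i := by
  simp [simpleTransposition_eq]

theorem simpleTransposition_of_ne {i : Fin (r - 1)} {k : Fin r} (h₁ : k ≠ lo i) (h₂ : k ≠ hi i) :
    simpleTransposition i k = k :=
  Equiv.swap_apply_of_ne_of_ne h₁ h₂

@[simp] theorem simpleTransposition_mul_self (i : Fin (r - 1)) :
    simpleTransposition i * simpleTransposition i = 1 :=
  Equiv.swap_mul_self _ _

@[simp] theorem simpleTransposition_inv (i : Fin (r - 1)) :
    (simpleTransposition i)⁻¹ = simpleTransposition i :=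
  Equiv.swap_inv _ _

@[simp] theorem mul_simpleTransposition_cancel (w : Equiv.Perm (Fin r)) (i : Fin (r - 1)) :
    w * simpleTransposition i * simpleTransposition i = w := by
  rw [mul_assoc, simpleTransposition_mul_self, mul_one]

/-- `i` is a (right) descent of `w`. -/
def Desc (w : Equiv.Perm (Fin r)) (i : Fin (r - 1)) : Prop := w (hi i) < w (lo i)

theorem not_desc_iff {w : Equiv.Perm (Fin r)} {i : Fin (r - 1)} :
    ¬ Desc w i ↔ w (lo i) < w (hi i) := by
  rw [Desc, not_lt]
  refine ⟨fun h => lt_of_le_of_ne h fun e => ?_, le_of_lt⟩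
  exact (lo_lt_hi i).ne (w.injective e)

theorem desc_mul_simpleTransposition {w : Equiv.Perm (Fin r)} {i : Fin (r - 1)} :
    Desc (w * simpleTransposition i) i ↔ ¬ Desc w i := by
  rw [not_desc_iff]; simp [Desc]

/-- The set of inversions of `w`. -/
def inversions (w : Equiv.Perm (Fin r)) : Finset (Fin r × Fin r) :=
  Finset.univ.filter fun p => p.1 < p.2 ∧ w p.2 < w p.1

theorem mem_inversions {w : Equiv.Perm (Fin r)} {p : Fin r × Fin r} :
    p ∈ inversions w ↔ p.1 < p.2 ∧ w p.2 < w p.1 := by simp [inversions]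

/-- The number of inversions of `w`. -/
def inv (w : Equiv.Perm (Fin r)) : ℕ := (inversions w).card

@[simp] theorem inv_one : inv (1 : Equiv.Perm (Fin r)) = 0 := by
  rw [inv, Finset.card_eq_zero, Finset.eq_empty_iff_forall_notMem]
  rintro ⟨a, b⟩ h
  rw [mem_inversions] at h
  exact lt_asymm h.1 h.2

theorem simpleTransposition_lt {i : Fin (r - 1)} {a b : Fin r} (hab : a < b)
    (h : ¬ (a = lo i ∧ b = hi i)) : simpleTransposition i a < simpleTransposition i b := by
  rw [simpleTransposition_eq, Equiv.swap_apply_def, Equiv.swap_apply_def]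
  simp only [Fin.ext_iff, Fin.lt_def, val_lo, val_hi] at *
  split_ifs <;> simp <;> omega

/-- Applying `s_i` to both coordinates maps the inversions of `w` injectively to inversions of `w
s_i`; the only one missed is the new pair `(i, i + 1)`. -/
theorem inv_mul_simpleTransposition {w : Equiv.Perm (Fin r)} {i : Fin (r - 1)}
    (h : ¬ Desc w i) : inv (w * simpleTransposition i) = inv w + 1 := by
  have h' := not_desc_iff.mp h
  have hn : ((lo i, hi i) : Fin r × Fin r) ∉ (inversions w).map
      ((simpleTransposition i).prodCongr (simpleTransposition i)).toEmbedding := by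
    intro hm
    rw [Finset.mem_map] at hm
    obtain ⟨⟨a, b⟩, hab, e⟩ := hm
    simp only [Equiv.coe_toEmbedding, Equiv.prodCongr_apply, Prod.map_apply, Prod.mk.injEq] at e
    obtain ⟨e₁, e₂⟩ := e
    have ha : a = hi i := (simpleTransposition i).injective (by simp [e₁])
    have hb : b = lo i := (simpleTransposition i).injective (by simp [e₂])
    rw [mem_inversions, ha, hb] at hab
    exact lt_asymm hab.1 (lo_lt_hi i)
  rw [inv, inv, ← Finset.card_map (s := inversions w)
    ((simpleTransposition i).prodCongr (simpleTransposition i)).toEmbedding,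
    ← Finset.card_cons hn]
  congr 1
  ext ⟨a, b⟩
  simp only [Finset.mem_cons, Finset.mem_map_equiv, mem_inversions, Prod.mk.injEq]
  have es : ∀ k, (simpleTransposition i).symm k = simpleTransposition i k := fun k => by
    rw [simpleTransposition_eq, Equiv.symm_swap]
  have ess : ∀ k, simpleTransposition i (simpleTransposition i k) = k := fun k => by
    rw [simpleTransposition_eq, Equiv.swap_apply_self]
  simp only [Equiv.Perm.mul_apply, Equiv.prodCongr_symm, Equiv.prodCongr_apply, Prod.map_apply, es]
  by_cases hab : a = lo i ∧ b = hi i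
  · obtain ⟨rfl, rfl⟩ := hab
    simpa [lo_lt_hi] using h'
  · constructor
    · rintro ⟨h₁, h₂⟩
      exact Or.inr ⟨simpleTransposition_lt h₁ hab, h₂⟩
    · rintro (h₁ | ⟨h₁, h₂⟩)
      · exact absurd h₁ hab
      · refine ⟨?_, h₂⟩
        have := simpleTransposition_lt h₁ (i := i) ?_
        · rwa [ess, ess] at this
        · rintro ⟨e₁, e₂⟩
          rw [e₁, e₂] at h₂
          exact lt_asymm h₂ h'

theorem inv_mul_simpleTransposition_of_desc {w : Equiv.Perm (Fin r)} {i : Fin (r - 1)}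
    (h : Desc w i) : inv (w * simpleTransposition i) + 1 = inv w := by
  have := inv_mul_simpleTransposition (w := w * simpleTransposition i) (i := i)
    (by rw [desc_mul_simpleTransposition]; exact not_not.mpr h)
  rw [mul_simpleTransposition_cancel] at this
  exact this.symm

theorem inv_inv_eq (w : Equiv.Perm (Fin r)) : inv w⁻¹ = inv w := by
  have key : ∀ u : Equiv.Perm (Fin r), inv u ≤ inv u⁻¹ := by
    intro u
    refine Finset.card_le_card_of_injOn (fun p => (u p.2, u p.1)) ?_ ?_
    · intro p hp
      have := mem_inversions.mp hp
      simp [mem_inversions, this]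
    · rintro ⟨a, b⟩ _ ⟨c, d⟩ _ h
      simp only [Prod.mk.injEq, EmbeddingLike.apply_eq_iff_eq] at h
      simp [h]
  exact le_antisymm (by simpa using key w⁻¹) (key w)

theorem monotone_of_lo_lt_hi {f : Fin r → Fin r} (h : ∀ i, f (lo i) < f (hi i)) :
    StrictMono f := by
  cases r with
  | zero => exact fun a => a.elim0
  | succ n => exact Fin.strictMono_iff_lt_succ.mpr h

/-- Without descents `w` is an order automorphism of a finite chain, and the identity is the only
one. -/
theorem eq_one_of_forall_not_desc {w : Equiv.Perm (Fin r)} (h : ∀ i, ¬ Desc w i) : w = 1 := by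
  have hm := monotone_of_lo_lt_hi fun i => not_desc_iff.mp (h i)
  ext1 k
  have hwk : w = (hm.orderIsoOfSurjective _ w.surjective).toEquiv := by ext; rfl
  have := Subsingleton.elim (hm.orderIsoOfSurjective _ w.surjective) (OrderIso.refl _)
  rw [hwk, this]; rfl

theorem eq_revPerm_of_forall_desc {w : Equiv.Perm (Fin r)} (h : ∀ i, Desc w i) :
    w = Fin.revPerm := by
  have : Fin.revPerm * w = 1 := eq_one_of_forall_not_desc fun i => by
    rw [not_desc_iff]
    simpa [Desc] using h i
  rw [← mul_one Fin.revPerm, ← this, ← mul_assoc]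
  ext; simp

theorem desc_revPerm (i : Fin (r - 1)) : Desc Fin.revPerm i := by
  simpa [Desc] using lo_lt_hi i

theorem exists_desc {w : Equiv.Perm (Fin r)} (h : inv w ≠ 0) : ∃ i, Desc w i := by
  by_contra hc
  push Not at hc
  exact h (by rw [eq_one_of_forall_not_desc hc, inv_one])

theorem eq_one_of_inv_eq_zero {w : Equiv.Perm (Fin r)} (h : inv w = 0) : w = 1 :=
  eq_one_of_forall_not_desc fun i hi => by
    have := inv_mul_simpleTransposition_of_desc hi
    omega

theorem inv_prod_le (l : List (Fin (r - 1))) : inv (l.map simpleTransposition).prod ≤ l.length := by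
  induction l using List.reverseRecOn with
  | nil => simp
  | append_singleton l i ih =>
    simp only [List.map_append, List.prod_append, List.map_cons, List.map_nil, List.prod_singleton,
      List.length_append, List.length_singleton]
    by_cases h : Desc (l.map simpleTransposition).prod i
    · have := inv_mul_simpleTransposition_of_desc h
      omega
    · rw [inv_mul_simpleTransposition h]
      omega

theorem exists_word_length_eq_inv (n : ℕ) : ∀ w : Equiv.Perm (Fin r), inv w = n →
    ∃ l : List (Fin (r - 1)), (l.map simpleTransposition).prod = w ∧ l.length = inv w := by
  induction n with
  | zero => intro w hw; exact ⟨[], by simp [eq_one_of_inv_eq_zero hw]⟩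
  | succ n ih =>
    intro w hw
    obtain ⟨i, hi⟩ := exists_desc (w := w) (by omega)
    have h := inv_mul_simpleTransposition_of_desc hi
    obtain ⟨l, hl, hl'⟩ := ih (w * simpleTransposition i) (by omega)
    exact ⟨l ++ [i], by simp [hl], by simp [hl', h]⟩

/-- Each letter raises `inv` by at most one, and removing descents one at a time yields a word of
exactly `inv w` letters. -/
theorem isReducedWord_iff {w : Equiv.Perm (Fin r)} {l : List (Fin (r - 1))} :
    IsReducedWord w l ↔ (l.map simpleTransposition).prod = w ∧ l.length = inv w := by
  constructor
  · rintro ⟨h₁, h₂⟩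
    obtain ⟨l', h₁', h₂'⟩ := exists_word_length_eq_inv _ w rfl
    refine ⟨h₁, le_antisymm (h₂' ▸ h₂ l' h₁') ?_⟩
    rw [← h₁]; exact inv_prod_le l
  · rintro ⟨h₁, h₂⟩
    refine ⟨h₁, fun l' h' => ?_⟩
    rw [h₂, ← h']; exact inv_prod_le l'

theorem permLength_eq_inv (w : Equiv.Perm (Fin r)) : permLength w = inv w :=
  (isReducedWord_iff.mp (isReducedWord_reducedWord w)).2

theorem isReducedWord_append_singleton {w : Equiv.Perm (Fin r)} {l : List (Fin (r - 1))}
    {i : Fin (r - 1)} :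
    IsReducedWord w (l ++ [i]) ↔ Desc w i ∧ IsReducedWord (w * simpleTransposition i) l := by
  simp only [isReducedWord_iff, List.map_append, List.prod_append, List.map_cons, List.map_nil,
    List.prod_singleton, List.length_append, List.length_singleton]
  constructor
  · rintro ⟨h₁, h₂⟩
    have h₃ : (l.map simpleTransposition).prod = w * simpleTransposition i := by
      rw [← h₁, mul_simpleTransposition_cancel]
    have hd : Desc w i := by
      by_contra hd
      have := inv_mul_simpleTransposition hd
      have := inv_prod_le l
      rw [h₃] at this
      omega
    have := inv_mul_simpleTransposition_of_desc hd
    exact ⟨hd, h₃, by omega⟩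
  · rintro ⟨hd, h₁, h₂⟩
    have := inv_mul_simpleTransposition_of_desc hd
    exact ⟨by rw [h₁, mul_simpleTransposition_cancel], by omega⟩

theorem IsReducedWord.reverse {w : Equiv.Perm (Fin r)} {l : List (Fin (r - 1))}
    (h : IsReducedWord w l) : IsReducedWord w⁻¹ l.reverse := by
  rw [isReducedWord_iff] at h ⊢
  rw [inv_inv_eq, List.length_reverse]
  refine ⟨?_, h.2⟩
  rw [← h.1, List.prod_inv_reverse, List.map_reverse, List.map_map]
  congr 2

/-! ### Commutation and braid relations, and their effect on descents -/

theorem simpleTransposition_comm {i j : Fin (r - 1)} (h : (i : ℕ) + 2 ≤ j ∨ (j : ℕ) + 2 ≤ i) :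
    simpleTransposition i * simpleTransposition j =
      simpleTransposition j * simpleTransposition i := by
  refine (Equiv.Perm.Disjoint.commute ?_).eq
  intro k
  by_cases hk : k = lo i ∨ k = hi i
  · right
    refine simpleTransposition_of_ne ?_ ?_ <;>
    · simp only [ne_eq, Fin.ext_iff, val_lo, val_hi] at *
      omega
  · push Not at hk
    exact Or.inl (simpleTransposition_of_ne hk.1 hk.2)

theorem desc_mul_simpleTransposition_of_far {w : Equiv.Perm (Fin r)} {i j : Fin (r - 1)}
    (h : (i : ℕ) + 2 ≤ j ∨ (j : ℕ) + 2 ≤ i) :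
    Desc (w * simpleTransposition i) j ↔ Desc w j := by
  have h₁ : simpleTransposition i (lo j) = lo j := by
    refine simpleTransposition_of_ne ?_ ?_ <;> simp only [ne_eq, Fin.ext_iff, val_lo, val_hi] <;>
      omega
  have h₂ : simpleTransposition i (hi j) = hi j := by
    refine simpleTransposition_of_ne ?_ ?_ <;> simp only [ne_eq, Fin.ext_iff, val_lo, val_hi] <;>
      omega
  simp [Desc, h₁, h₂]

theorem hi_eq_lo_of_succ {i j : Fin (r - 1)} (h : (i : ℕ) + 1 = j) :
    hi i = lo j := by simp [Fin.ext_iff, h]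

theorem simpleTransposition_hi_of_succ {i j : Fin (r - 1)} (h : (i : ℕ) + 1 = j) :
    simpleTransposition i (hi j) = hi j := by
  refine simpleTransposition_of_ne ?_ ?_ <;> simp only [ne_eq, Fin.ext_iff, val_lo, val_hi] <;>
    omega

theorem simpleTransposition_lo_of_succ {i j : Fin (r - 1)} (h : (i : ℕ) + 1 = j) :
    simpleTransposition j (lo i) = lo i := by
  refine simpleTransposition_of_ne ?_ ?_ <;> simp only [ne_eq, Fin.ext_iff, val_lo, val_hi] <;>
    omega

theorem desc_mul_left_right {i j : Fin (r - 1)} (h : (i : ℕ) + 1 = j)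
    {w : Equiv.Perm (Fin r)} :
    Desc (w * simpleTransposition i) j ↔ w (hi j) < w (lo i) := by
  simp [Desc, simpleTransposition_hi_of_succ h, ← hi_eq_lo_of_succ h]

theorem desc_mul_right_left {i j : Fin (r - 1)} (h : (i : ℕ) + 1 = j)
    {w : Equiv.Perm (Fin r)} :
    Desc (w * simpleTransposition j) i ↔ w (hi j) < w (lo i) := by
  simp [Desc, simpleTransposition_lo_of_succ h, hi_eq_lo_of_succ h]

theorem desc_mul_left_mul_right {i j : Fin (r - 1)} (h : (i : ℕ) + 1 = j)
    {w : Equiv.Perm (Fin r)} :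
    Desc (w * simpleTransposition i * simpleTransposition j) i ↔ Desc w j := by
  rw [desc_mul_right_left h]
  simp [Desc, simpleTransposition_hi_of_succ h, ← hi_eq_lo_of_succ h]

theorem desc_mul_right_mul_left {i j : Fin (r - 1)} (h : (i : ℕ) + 1 = j)
    {w : Equiv.Perm (Fin r)} :
    Desc (w * simpleTransposition j * simpleTransposition i) j ↔ Desc w i := by
  rw [desc_mul_left_right h]
  simp [Desc, simpleTransposition_lo_of_succ h, hi_eq_lo_of_succ h]

theorem simpleTransposition_braid {i j : Fin (r - 1)} (h : (i : ℕ) + 1 = j) :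
    simpleTransposition i * simpleTransposition j * simpleTransposition i =
      simpleTransposition j * simpleTransposition i * simpleTransposition j := by
  have h₁ := Equiv.swap_mul_swap_mul_swap (x := lo i) (y := hi i) (z := hi j)
    (lo_lt_hi i).ne (by simp only [ne_eq, Fin.ext_iff, val_lo, val_hi]; omega)
  have h₂ := Equiv.swap_mul_swap_mul_swap (x := hi j) (y := hi i) (z := lo i)
    (by simp only [ne_eq, Fin.ext_iff, val_hi]; omega)
    (by simp only [ne_eq, Fin.ext_iff, val_lo, val_hi]; omega)
  rw [simpleTransposition_eq, simpleTransposition_eq, ← hi_eq_lo_of_succ h]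
  rw [Equiv.swap_comm (hi j) (hi i), Equiv.swap_comm (hi i) (lo i),
    Equiv.swap_comm (lo i) (hi j)] at h₂
  rw [h₂, ← h₁]

/-- Two reduced words of the same permutation have the same product in every monoid in which the
braid relations hold. -/
theorem IsReducedWord.map_prod_eq {M : Type*} [Monoid M] (f : Fin (r - 1) → M)
    (braid : ∀ i j : Fin (r - 1), (i : ℕ) + 1 = j → f i * f j * f i = f j * f i * f j)
    (comm : ∀ i j : Fin (r - 1), (i : ℕ) + 2 ≤ j ∨ (j : ℕ) + 2 ≤ i → f i * f j = f j * f i)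
    {w : Equiv.Perm (Fin r)} {l l' : List (Fin (r - 1))}
    (hl : IsReducedWord w l) (hl' : IsReducedWord w l') :
    (l.map f).prod = (l'.map f).prod := by
  obtain ⟨n, hn⟩ : ∃ n, inv w = n := ⟨_, rfl⟩
  induction n using Nat.strong_induction_on generalizing w l l' with
  | _ n ih =>
    have hlen : l.length = l'.length := by
      rw [(isReducedWord_iff.mp hl).2, (isReducedWord_iff.mp hl').2]
    rcases List.eq_nil_or_concat' l with rfl | ⟨k, i, rfl⟩
    · have : l' = [] := List.length_eq_zero_iff.mp hlen.symm
      rw [this]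
    rcases List.eq_nil_or_concat' l' with rfl | ⟨k', j, rfl⟩
    · simp at hlen
    rw [isReducedWord_append_singleton] at hl hl'
    obtain ⟨hdi, hk⟩ := hl
    obtain ⟨hdj, hk'⟩ := hl'
    have hni := inv_mul_simpleTransposition_of_desc hdi
    have hnj := inv_mul_simpleTransposition_of_desc hdj
    -- Adjacent last letters: `w` decreases on three consecutive positions, so it has reduced words
    -- ending in `i j i` and in `j i j` with a common beginning `m`. Induction links each given word
    -- to one of these, and the braid relation links the two.
    have adj : ∀ (i j : Fin (r - 1)) (k k' : List (Fin (r - 1))), (i : ℕ) + 1 = j → Desc w i →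
        Desc w j → IsReducedWord (w * simpleTransposition i) k →
        IsReducedWord (w * simpleTransposition j) k' →
        ((k ++ [i]).map f).prod = ((k' ++ [j]).map f).prod := by
      intro i j k k' h hdi hdj hk hk'
      have hlt : w (hi j) < w (lo i) := by
        have h₁ := hdi
        have h₂ := hdj
        rw [Desc, hi_eq_lo_of_succ h] at h₁
        exact lt_trans h₂ h₁
      obtain ⟨m, hm⟩ := exists_reducedWord
        (w * simpleTransposition i * simpleTransposition j * simpleTransposition i)
      have h₁ : IsReducedWord (w * simpleTransposition i) ((m ++ [i]) ++ [j]) := by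
        rw [isReducedWord_append_singleton, isReducedWord_append_singleton]
        exact ⟨(desc_mul_left_right h).mpr hlt, (desc_mul_left_mul_right h).mpr hdj, hm⟩
      have h₂ : IsReducedWord (w * simpleTransposition j) ((m ++ [j]) ++ [i]) := by
        rw [isReducedWord_append_singleton, isReducedWord_append_singleton]
        refine ⟨(desc_mul_right_left h).mpr hlt, (desc_mul_right_mul_left h).mpr hdi, ?_⟩
        rw [mul_assoc, mul_assoc, ← mul_assoc (simpleTransposition j),
          ← simpleTransposition_braid h]
        simpa [mul_assoc] using hm
      have hni := inv_mul_simpleTransposition_of_desc hdi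
      have hnj := inv_mul_simpleTransposition_of_desc hdj
      have e₁ := ih _ (by omega) hk h₁ rfl
      have e₂ := ih _ (by omega) hk' h₂ rfl
      simp only [List.map_append, List.prod_append, List.map_cons, List.map_nil,
        List.prod_singleton] at e₁ e₂ ⊢
      rw [e₁, e₂, mul_assoc, mul_assoc, ← mul_assoc (f i), braid i j h]
      simp only [mul_assoc]
    by_cases hfar : (i : ℕ) + 2 ≤ j ∨ (j : ℕ) + 2 ≤ i
    · obtain ⟨m, hm⟩ := exists_reducedWord (w * simpleTransposition i * simpleTransposition j)
      have h₁ : IsReducedWord (w * simpleTransposition i) (m ++ [j]) :=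
        isReducedWord_append_singleton.mpr
          ⟨(desc_mul_simpleTransposition_of_far hfar).mpr hdj, hm⟩
      have h₂ : IsReducedWord (w * simpleTransposition j) (m ++ [i]) := by
        refine isReducedWord_append_singleton.mpr
          ⟨(desc_mul_simpleTransposition_of_far hfar.symm).mpr hdi, ?_⟩
        rwa [mul_assoc, ← simpleTransposition_comm hfar, ← mul_assoc]
      have e₁ := ih _ (by omega) hk h₁ rfl
      have e₂ := ih _ (by omega) hk' h₂ rfl
      simp only [List.map_append, List.prod_append, List.map_cons, List.map_nil,
        List.prod_singleton] at e₁ e₂ ⊢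
      rw [e₁, e₂, mul_assoc, mul_assoc, comm i j hfar]
    · rcases lt_trichotomy (i : ℕ) j with hij | hij | hij
      · exact adj i j k k' (by omega) hdi hdj hk hk'
      · obtain rfl : i = j := Fin.ext hij
        rw [List.map_append, List.prod_append, ih _ (by omega) hk hk' rfl, List.map_append,
          List.prod_append]
      · exact (adj j i k' k (by omega) hdj hdi hk' hk).symm

/-! ### Longest elements of parabolic subgroups -/

/-- The generators `s_j` with `j ≠ i` all stabilise the initial segment ending at `lo i`. -/
theorem le_iff_apply_le_of_mem_parabolic {S : Finset (Fin (r - 1))} {w : Equiv.Perm (Fin r)}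
    (hw : w ∈ parabolic S) {i : Fin (r - 1)} (hi' : i ∉ S) (k : Fin r) :
    w k ≤ lo i ↔ k ≤ lo i := by
  induction hw using Subgroup.closure_induction generalizing k with
  | mem x hx =>
    obtain ⟨j, hj, rfl⟩ := hx
    have hji : j ≠ i := fun e => hi' (e ▸ hj)
    rw [simpleTransposition_eq, Equiv.swap_apply_def]
    split_ifs <;> simp only [ne_eq, Fin.ext_iff, Fin.le_def, val_lo, val_hi] at * <;> omega
  | one => rfl
  | mul x y _ _ hx hy => rw [Equiv.Perm.mul_apply, hx, hy]
  | inv x _ hx => rw [← hx]; simp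

theorem simpleTransposition_mem_parabolic {S : Finset (Fin (r - 1))} {i : Fin (r - 1)}
    (hi : i ∈ S) : simpleTransposition i ∈ parabolic S :=
  Subgroup.subset_closure ⟨i, hi, rfl⟩

/-- The last letter is a descent of `w`. A descent at `i ∉ S` would contradict the invariance of the
segment up to `lo i`. -/
theorem IsReducedWord.mem_of_mem_parabolic {S : Finset (Fin (r - 1))} {w : Equiv.Perm (Fin r)}
    (hw : w ∈ parabolic S) {l : List (Fin (r - 1))} (hl : IsReducedWord w l) :
    ∀ i ∈ l, i ∈ S := by
  induction l using List.reverseRecOn generalizing w with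
  | nil => simp
  | append_singleton l i ih =>
    rw [isReducedWord_append_singleton] at hl
    have hi' : i ∈ S := by
      by_contra hn
      have h₁ := (le_iff_apply_le_of_mem_parabolic hw hn (lo i)).mpr le_rfl
      have h₂ := (le_iff_apply_le_of_mem_parabolic hw hn (hi i)).not.mpr
        (not_le.mpr (lo_lt_hi i))
      exact h₂ (hl.1.le.trans h₁)
    intro j hj
    rw [List.mem_append, List.mem_singleton] at hj
    rcases hj with hj | rfl
    · exact ih (mul_mem hw (simpleTransposition_mem_parabolic hi')) hl.2 j hj
    · exact hi'

theorem mem_of_mem_reducedWord_longest {S : Finset (Fin (r - 1))} :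
    ∀ i ∈ reducedWord (longest S), i ∈ S :=
  (isReducedWord_reducedWord _).mem_of_mem_parabolic (longest_spec S).1

/-- Otherwise `w₀(S) s_i` would be a longer element of the parabolic subgroup. -/
theorem desc_longest {S : Finset (Fin (r - 1))} {i : Fin (r - 1)} (hi : i ∈ S) :
    Desc (longest S) i := by
  by_contra hd
  have h₁ := inv_mul_simpleTransposition hd
  have h₂ := (longest_spec S).2 _
    (mul_mem (longest_spec S).1 (simpleTransposition_mem_parabolic hi))
  rw [permLength_eq_inv, permLength_eq_inv] at h₂
  omega

theorem desc_inv_longest {S : Finset (Fin (r - 1))} {i : Fin (r - 1)} (hi : i ∈ S) :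
    Desc (longest S)⁻¹ i := by
  by_contra hd
  have h₁ := inv_mul_simpleTransposition hd
  have h₂ := (longest_spec S).2 _ (inv_mem
    (mul_mem (inv_mem (longest_spec S).1) (simpleTransposition_mem_parabolic hi)))
  rw [permLength_eq_inv, permLength_eq_inv, inv_inv_eq, h₁, inv_inv_eq] at h₂
  omega

end Perm

/-! ### The 0-Hecke algebra: universal property and the standard basis -/

section Algebra

variable {r : ℕ}

/-- Signs in `Hecke r` are written as the scalar `-1` from here on, so that semiring and `ℂ`-module
structures suffice. -/
theorem freeAlgebra_neg {X : Type*} (x : FreeAlgebra ℂ X) : -x = (-1 : ℂ) • x :=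
  (neg_one_smul ℂ x).symm

theorem opi_mul_self (i : Fin (r - 1)) : opi i * opi i = (-1 : ℂ) • opi i := by
  have := RingQuot.mkAlgHom_rel ℂ (Rel.quad i)
  rw [freeAlgebra_neg, map_mul, map_smul] at this
  exact this

theorem opi_braid (i j : Fin (r - 1)) (h : (i : ℕ) + 1 = j) :
    opi i * opi j * opi i = opi j * opi i * opi j := by
  have := RingQuot.mkAlgHom_rel ℂ (Rel.braid i j h)
  simpa [opi] using this

theorem opi_comm (i j : Fin (r - 1)) (h : (i : ℕ) + 2 ≤ j ∨ (j : ℕ) + 2 ≤ i) :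
    opi i * opi j = opi j * opi i := by
  have := RingQuot.mkAlgHom_rel ℂ (Rel.comm i j h)
  simpa [opi] using this

/-- The universal property of the 0-Hecke algebra. -/
def lift {A : Type*} [Semiring A] [Algebra ℂ A] (f : Fin (r - 1) → A)
    (quad : ∀ i, f i * f i = (-1 : ℂ) • f i)
    (braid : ∀ i j : Fin (r - 1), (i : ℕ) + 1 = j → f i * f j * f i = f j * f i * f j)
    (comm : ∀ i j : Fin (r - 1), (i : ℕ) + 2 ≤ j ∨ (j : ℕ) + 2 ≤ i → f i * f j = f j * f i) :
    Hecke r →ₐ[ℂ] A :=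
  RingQuot.liftAlgHom ℂ ⟨FreeAlgebra.lift ℂ f, by
    rintro _ _ (i | ⟨i, j, h⟩ | ⟨i, j, h⟩)
    · rw [freeAlgebra_neg, map_mul, map_smul, FreeAlgebra.lift_ι_apply]
      exact quad i
    · simpa using braid i j h
    · simpa using comm i j h⟩

@[simp] theorem lift_opi {A : Type*} [Semiring A] [Algebra ℂ A] (f : Fin (r - 1) → A)
    (quad : ∀ i, f i * f i = (-1 : ℂ) • f i)
    (braid : ∀ i j : Fin (r - 1), (i : ℕ) + 1 = j → f i * f j * f i = f j * f i * f j)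
    (comm : ∀ i j : Fin (r - 1), (i : ℕ) + 2 ≤ j ∨ (j : ℕ) + 2 ≤ i → f i * f j = f j * f i)
    (i : Fin (r - 1)) : lift f quad braid comm (opi i) = f i := by
  rw [lift, opi, RingQuot.liftAlgHom_mkAlgHom_apply, FreeAlgebra.lift_ι_apply]

theorem algHom_ext {A : Type*} [Semiring A] [Algebra ℂ A] {f g : Hecke r →ₐ[ℂ] A}
    (h : ∀ i, f (opi i) = g (opi i)) : f = g := by
  apply RingQuot.ringQuot_ext'
  apply FreeAlgebra.hom_ext
  funext i
  exact h i

theorem hecke_induction {p : Hecke r → Prop} (algebraMap : ∀ c : ℂ, p (algebraMap ℂ _ c))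
    (opi : ∀ i, p (opi i)) (mul : ∀ a b, p a → p b → p (a * b))
    (add : ∀ a b, p a → p b → p (a + b)) (h : Hecke r) : p h := by
  obtain ⟨x, rfl⟩ := RingQuot.mkAlgHom_surjective ℂ (Rel r) h
  induction x using FreeAlgebra.induction with
  | grade0 c => rw [AlgHom.commutes]; exact algebraMap c
  | grade1 i => exact opi i
  | mul a b ha hb => rw [map_mul]; exact mul _ _ ha hb
  | add a b ha hb => rw [map_add]; exact add _ _ ha hb

/-- The anti-automorphism fixing the generators. -/
def antiAut (r : ℕ) : Hecke r →ₐ[ℂ] (Hecke r)ᵐᵒᵖ :=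
  lift (fun i => MulOpposite.op (opi i))
    (fun i => by rw [← MulOpposite.op_mul, opi_mul_self, MulOpposite.op_smul])
    (fun i j h => by simp only [← MulOpposite.op_mul, ← mul_assoc, opi_braid i j h])
    (fun i j h => by simp only [← MulOpposite.op_mul, opi_comm i j h])

/-- The anti-automorphism fixing the generators, as a linear map. -/
def flip (r : ℕ) : Hecke r →ₗ[ℂ] Hecke r :=
  (MulOpposite.opLinearEquiv ℂ).symm.toLinearMap ∘ₗ (antiAut r).toLinearMap

theorem flip_apply (h : Hecke r) : flip r h = (antiAut r h).unop := rfl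

@[simp] theorem flip_opi (i : Fin (r - 1)) : flip r (opi i) = opi i := by
  simp [flip_apply, antiAut]

@[simp] theorem flip_one : flip r 1 = 1 := by simp [flip_apply]

@[simp] theorem flip_mul (a b : Hecke r) : flip r (a * b) = flip r b * flip r a := by
  simp [flip_apply]

@[simp] theorem flip_pi (i : Fin (r - 1)) : flip r (pi i) = pi i := by
  simp [pi]

@[simp] theorem flip_flip (a : Hecke r) : flip r (flip r a) = a := by
  induction a using hecke_induction with
  | algebraMap c => simp [Algebra.algebraMap_eq_smul_one]
  | opi i => simp
  | mul a b ha hb => simp [ha, hb]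
  | add a b ha hb => simp [ha, hb]

theorem flip_list_prod {ι : Type*} (f : ι → Hecke r) (hf : ∀ i, flip r (f i) = f i) (l : List ι) :
    flip r (l.map f).prod = (l.reverse.map f).prod := by
  induction l with
  | nil => simp
  | cons i l ih => simp [ih, hf]

theorem opiPerm_eq {w : Equiv.Perm (Fin r)} {l : List (Fin (r - 1))} (hl : IsReducedWord w l) :
    opiPerm w = (l.map opi).prod :=
  (isReducedWord_reducedWord w).map_prod_eq opi opi_braid opi_comm hl

theorem flip_opiPerm (w : Equiv.Perm (Fin r)) : flip r (opiPerm w) = opiPerm w⁻¹ := by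
  rw [opiPerm_eq (isReducedWord_reducedWord w).reverse, opiPerm, flip_list_prod _ flip_opi]

/-! ### Right multiplication by the generators and the standard basis -/

instance (w : Equiv.Perm (Fin r)) (i : Fin (r - 1)) : Decidable (Desc w i) :=
  inferInstanceAs (Decidable (_ < _))

theorem opiPerm_mul_opi_of_not_desc {w : Equiv.Perm (Fin r)} {i : Fin (r - 1)}
    (h : ¬ Desc w i) : opiPerm w * opi i = opiPerm (w * simpleTransposition i) := by
  have : IsReducedWord (w * simpleTransposition i) (reducedWord w ++ [i]) := by
    rw [isReducedWord_append_singleton, desc_mul_simpleTransposition,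
      mul_simpleTransposition_cancel]
    exact ⟨h, isReducedWord_reducedWord w⟩
  rw [opiPerm_eq this]
  simp [opiPerm]

theorem opiPerm_mul_opi_of_desc {w : Equiv.Perm (Fin r)} {i : Fin (r - 1)}
    (h : Desc w i) : opiPerm w * opi i = (-1 : ℂ) • opiPerm w := by
  have h' : ¬ Desc (w * simpleTransposition i) i := by
    rw [desc_mul_simpleTransposition]; exact not_not.mpr h
  have e := opiPerm_mul_opi_of_not_desc h'
  rw [mul_simpleTransposition_cancel] at e
  rw [← e, mul_assoc, opi_mul_self, mul_smul_comm]

@[simp] theorem opiPerm_one : opiPerm (1 : Equiv.Perm (Fin r)) = 1 := by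
  rw [opiPerm_eq (l := []) (by simp [isReducedWord_iff])]
  simp

/-- The span is stable under right multiplication by the generators, hence a right ideal, and it
contains `1`. -/
theorem span_opiPerm : Submodule.span ℂ (Set.range (opiPerm (r := r))) = ⊤ := by
  have key : ∀ h : Hecke r, ∀ x ∈ Submodule.span ℂ (Set.range (opiPerm (r := r))),
      x * h ∈ Submodule.span ℂ (Set.range (opiPerm (r := r))) := by
    intro h
    induction h using hecke_induction with
    | algebraMap c =>
      intro x hx
      rw [Algebra.algebraMap_eq_smul_one, mul_smul_comm, mul_one]
      exact Submodule.smul_mem _ _ hx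
    | opi i =>
      intro x hx
      induction hx using Submodule.span_induction with
      | mem x hx =>
        obtain ⟨w, rfl⟩ := hx
        by_cases hd : Desc w i
        · rw [opiPerm_mul_opi_of_desc hd]
          exact Submodule.smul_mem _ _ (Submodule.subset_span ⟨w, rfl⟩)
        · rw [opiPerm_mul_opi_of_not_desc hd]
          exact Submodule.subset_span ⟨_, rfl⟩
      | zero => simp
      | add x y _ _ hx hy => rw [add_mul]; exact add_mem hx hy
      | smul c x _ hx => rw [smul_mul_assoc]; exact Submodule.smul_mem _ _ hx
    | mul a b ha hb => intro x hx; rw [← mul_assoc]; exact hb _ (ha _ hx)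
    | add a b ha hb => intro x hx; rw [mul_add]; exact add_mem (ha _ hx) (hb _ hx)
  rw [eq_top_iff]
  intro h _
  simpa using key h 1 (Submodule.subset_span ⟨1, opiPerm_one⟩)

/-- The operator of right multiplication by `π̄_i` in the standard basis. -/
def regularOp (i : Fin (r - 1)) : Module.End ℂ (Equiv.Perm (Fin r) →₀ ℂ) :=
  Finsupp.linearCombination ℂ fun w =>
    if Desc w i then -Finsupp.single w 1 else Finsupp.single (w * simpleTransposition i) 1

theorem regularOp_single (i : Fin (r - 1)) (w : Equiv.Perm (Fin r)) :
    regularOp i (Finsupp.single w 1) =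
      if Desc w i then -Finsupp.single w 1 else Finsupp.single (w * simpleTransposition i) 1 := by
  simp [regularOp]

theorem regularOp_mul_self (i : Fin (r - 1)) : regularOp i * regularOp i = (-1 : ℂ) • regularOp i := by
  apply Finsupp.lhom_ext'
  intro w
  apply LinearMap.ext_ring
  by_cases h : Desc w i <;>
    simp [regularOp_single, h, desc_mul_simpleTransposition]

theorem regularOp_braid (i j : Fin (r - 1)) (h : (i : ℕ) + 1 = j) :
    regularOp i * regularOp j * regularOp i = regularOp j * regularOp i * regularOp j := by
  apply Finsupp.lhom_ext'
  intro w
  apply LinearMap.ext_ring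
  have hb := simpleTransposition_braid h
  have h₁ : w (hi i) = w (lo j) := by rw [hi_eq_lo_of_succ h]
  have hb' : w * simpleTransposition i * simpleTransposition j * simpleTransposition i =
      w * simpleTransposition j * simpleTransposition i * simpleTransposition j := by
    simpa [mul_assoc] using congrArg (w * ·) hb
  have h₂ : Desc w i → Desc w j → w (hi j) < w (lo i) := fun hp hq =>
    lt_trans hq (by rw [← h₁]; exact hp)
  have h₃ : ¬ Desc w i → ¬ Desc w j → ¬ w (hi j) < w (lo i) := fun hp hq => by
    rw [not_desc_iff] at hp hq
    exact not_lt.mpr (lt_trans hp (by rw [h₁]; exact hq)).le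
  have h₄ : w (hi j) < w (lo j) ↔ Desc w j := Iff.rfl
  have h₆ : w (lo j) < w (lo i) ↔ Desc w i := by rw [← h₁]; rfl
  -- The relative order of the three values of `w` at `lo i`, `hi i`, `hi j` decides every descent
  -- that occurs; `h₂` and `h₃` discard the two impossible patterns.
  by_cases hp : Desc w i <;> by_cases hq : Desc w j <;> by_cases ht : w (hi j) < w (lo i) <;>
    simp [hp, hq, ht] at h₂ h₃ <;>
    simp [regularOp_single, hp, hq, ht, desc_mul_simpleTransposition, desc_mul_left_right h,
      desc_mul_right_left h, simpleTransposition_hi_of_succ h, simpleTransposition_lo_of_succ h,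
      h₁, h₄, h₆, hb']

theorem regularOp_comm (i j : Fin (r - 1)) (h : (i : ℕ) + 2 ≤ j ∨ (j : ℕ) + 2 ≤ i) :
    regularOp i * regularOp j = regularOp j * regularOp i := by
  apply Finsupp.lhom_ext'
  intro w
  apply LinearMap.ext_ring
  have hc := simpleTransposition_comm h
  by_cases hp : Desc w i <;> by_cases hq : Desc w j <;>
    simp [regularOp_single, hp, hq, desc_mul_simpleTransposition_of_far h,
      desc_mul_simpleTransposition_of_far h.symm, mul_assoc, hc]

/-- The regular representation in the standard basis. -/
def regularRep (r : ℕ) : Hecke r →ₐ[ℂ] Module.End ℂ (Equiv.Perm (Fin r) →₀ ℂ) :=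
  lift regularOp regularOp_mul_self regularOp_braid regularOp_comm

/-- The operators multiply by letters on the right, but a product of operators applies its last
factor first; hence the reversed word. -/
theorem regularRep_word {w : Equiv.Perm (Fin r)} {l : List (Fin (r - 1))}
    (hl : IsReducedWord w l) :
    regularRep r (l.reverse.map opi).prod (Finsupp.single 1 1) = Finsupp.single w 1 := by
  induction l using List.reverseRecOn generalizing w with
  | nil =>
    have : w = 1 := by simpa [eq_comm] using (isReducedWord_iff.mp hl).1
    simp [this]
  | append_singleton l i ih =>
    rw [isReducedWord_append_singleton] at hl
    rw [List.reverse_append]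
    simp only [List.reverse_cons, List.reverse_nil, List.nil_append, List.cons_append,
      List.map_cons, List.prod_cons, map_mul, Module.End.mul_apply, ih hl.2]
    rw [regularRep, lift_opi, regularOp_single, if_neg, mul_simpleTransposition_cancel]
    rw [desc_mul_simpleTransposition]
    exact not_not.mpr hl.1

theorem linearIndependent_opiPerm : LinearIndependent ℂ (opiPerm (r := r)) := by
  have h₁ : LinearIndependent ℂ
      fun w : Equiv.Perm (Fin r) => (Finsupp.single w⁻¹ 1 : Equiv.Perm (Fin r) →₀ ℂ) := by
    simpa [Function.comp_def] using
      (Finsupp.basisSingleOne (R := ℂ) (ι := Equiv.Perm (Fin r))).linearIndependent.comp _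
        inv_injective
  refine LinearIndependent.of_comp
    ((LinearMap.applyₗ (Finsupp.single 1 1)) ∘ₗ (regularRep r).toLinearMap) ?_
  convert h₁ with w
  have := regularRep_word (isReducedWord_reducedWord w).reverse
  rw [List.reverse_reverse] at this
  exact this

/-- The standard basis `π̄_w` of the 0-Hecke algebra. -/
def stdBasis (r : ℕ) : Module.Basis (Equiv.Perm (Fin r)) ℂ (Hecke r) :=
  Module.Basis.mk linearIndependent_opiPerm span_opiPerm.ge

@[simp] theorem stdBasis_apply (w : Equiv.Perm (Fin r)) : stdBasis r w = opiPerm w := by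
  simp [stdBasis]

instance : Module.Finite ℂ (Hecke r) := Module.Finite.of_basis (stdBasis r)

/-- The coefficient of `π̄_v`. -/
def coeff (v : Equiv.Perm (Fin r)) : Hecke r →ₗ[ℂ] ℂ := (stdBasis r).coord v

theorem coeff_opiPerm (v w : Equiv.Perm (Fin r)) :
    coeff v (opiPerm w) = if w = v then 1 else 0 := by
  rw [coeff, ← stdBasis_apply, Module.Basis.coord_apply, Module.Basis.repr_self,
    Finsupp.single_apply]

theorem eq_zero_of_coeff {h : Hecke r} (hh : ∀ v, coeff v h = 0) : h = 0 :=
  (stdBasis r).forall_coord_eq_zero_iff.mp hh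

/-- A term `π̄_v` of `h π̄_i` comes from `π̄_{v s_i}` by lengthening or from `π̄_v` with sign `-1`,
and both require `i` to be a descent of `v`. -/
theorem coeff_mul_opi (v : Equiv.Perm (Fin r)) (i : Fin (r - 1)) (h : Hecke r) :
    coeff v (h * opi i) =
      if Desc v i then coeff (v * simpleTransposition i) h - coeff v h else 0 := by
  have key : coeff v ∘ₗ LinearMap.mulRight ℂ (opi i) =
      if Desc v i then coeff (v * simpleTransposition i) - coeff v else 0 := by
    refine (stdBasis r).ext fun w => ?_
    rw [stdBasis_apply, LinearMap.comp_apply, LinearMap.mulRight_apply]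
    have hs : ∀ u, u * simpleTransposition i = v ↔ u = v * simpleTransposition i := fun u =>
      ⟨fun e => by simp [← e], fun e => by simp [e]⟩
    have hvs : v ≠ v * simpleTransposition i := fun e => by
      have := desc_mul_simpleTransposition (w := v) (i := i)
      rw [← e] at this
      tauto
    by_cases hw : Desc w i
    · rw [opiPerm_mul_opi_of_desc hw, map_smul, coeff_opiPerm]
      have hwv : w ≠ v * simpleTransposition i ∨ ¬ Desc v i := by
        by_contra hc
        push Not at hc
        rw [hc.1, desc_mul_simpleTransposition] at hw
        exact hw hc.2
      by_cases hv : Desc v i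
      · have := hwv.resolve_right (not_not.mpr hv)
        by_cases hwv' : w = v <;> simp [hv, coeff_opiPerm, this, hwv', hvs]
      · have : w ≠ v := fun e => hv (e ▸ hw)
        simp [hv, this]
    · rw [opiPerm_mul_opi_of_not_desc hw, coeff_opiPerm]
      by_cases hv : Desc v i
      · have : w ≠ v := fun e => hw (e ▸ hv)
        simp [hv, coeff_opiPerm, this, hs]
      · have : w ≠ v * simpleTransposition i := fun e => by
          rw [e, desc_mul_simpleTransposition] at hw
          exact hw hv
        simp [hv, hs, this]
  have := LinearMap.congr_fun key h
  rw [LinearMap.comp_apply, LinearMap.mulRight_apply] at this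
  rw [this]
  split_ifs <;> simp

theorem coeff_mul_pi (v : Equiv.Perm (Fin r)) (i : Fin (r - 1)) (h : Hecke r) :
    coeff v (h * pi i) =
      if Desc v i then coeff (v * simpleTransposition i) h else coeff v h := by
  rw [pi, mul_add, mul_one, map_add, coeff_mul_opi]
  split_ifs <;> simp

theorem coeff_flip (v : Equiv.Perm (Fin r)) (h : Hecke r) :
    coeff v (flip r h) = coeff v⁻¹ h := by
  have key : coeff v ∘ₗ flip r = coeff v⁻¹ := by
    refine (stdBasis r).ext fun w => ?_
    simp [flip_opiPerm, coeff_opiPerm, inv_eq_iff_eq_inv]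
  exact LinearMap.congr_fun key h

end Algebra

/-! ### Group invertible elements and the spaces `aAb` -/

section GroupInvertible

variable {K A : Type*} [Field K] [Semiring A] [Algebra K A]

/-- `a` has a group inverse: `a = a²s` for some `s` that commutes with `a`. -/
def GroupInvertible (a : A) : Prop := ∃ s, Commute a s ∧ a * a * s = a

/-- If `T²` and `T` have the same kernel, then `T` is injective on its finite-dimensional range,
hence surjective there. -/
theorem exists_apply_apply_eq {V : Type*} [AddCommMonoid V] [Module K V] [Module.Finite K V]
    (T : V →ₗ[K] V) (hT : ∀ v, T (T v) = 0 → T v = 0) (v : V) : ∃ z, T (T z) = T v := by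
  let _ : AddCommGroup V := Module.addCommMonoidToAddCommGroup K
  let U : LinearMap.range T →ₗ[K] LinearMap.range T := T.restrict fun x _ => ⟨x, rfl⟩
  have hU : Function.Injective U := by
    rw [injective_iff_map_eq_zero]
    rintro ⟨_, x, rfl⟩ hx
    exact Subtype.ext (hT x (congrArg Subtype.val hx))
  obtain ⟨⟨_, z, rfl⟩, hz⟩ := LinearMap.injective_iff_surjective.mp hU ⟨T v, v, rfl⟩
  exact ⟨z, congrArg Subtype.val hz⟩

variable (K) in
-- The kernel condition on right multiplication gives `a = c a²`. This implies the same condition on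
-- left multiplication, whence `a = a² d`. Then `c a = a d`, and `s = c a d` is the required
-- element.
theorem groupInvertible_of_mul_right [Module.Finite K A] {a : A}
    (ha : ∀ h, h * a * a = 0 → h * a = 0) : GroupInvertible a := by
  obtain ⟨c, hc⟩ := exists_apply_apply_eq (LinearMap.mulRight K a) (by simpa using ha) 1
  have hc' : c * a * a = a := by simpa using hc
  obtain ⟨d, hd⟩ := exists_apply_apply_eq (LinearMap.mulLeft K a) (fun h hh => by
    simp only [LinearMap.mulLeft_apply] at hh ⊢
    rw [← hc', mul_assoc, mul_assoc, hh, mul_zero]) 1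
  have hd' : a * (a * d) = a := by simpa using hd
  have e₁ : c * a = a * d := by
    calc c * a = c * a * a * d := by rw [mul_assoc, mul_assoc, hd']
      _ = a * d := by rw [hc']
  have e₂ : a * (c * a * d) = a * d := by
    rw [e₁, ← mul_assoc, hd']
  have e₃ : c * a * d * a = a * d := by
    rw [mul_assoc, mul_assoc, ← mul_assoc a d, ← e₁, hc', e₁]
  refine ⟨c * a * d, ?_, ?_⟩
  · rw [Commute, SemiconjBy, e₂, e₃]
  · rw [mul_assoc, e₂, hd']

theorem GroupInvertible.smul {a : A} (ha : GroupInvertible a) {c : K} (hc : c ≠ 0) :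
    GroupInvertible (c • a) := by
  obtain ⟨s, h₁, h₂⟩ := ha
  refine ⟨c⁻¹ • s, (h₁.smul_left c).smul_right c⁻¹, ?_⟩
  simp only [smul_mul_assoc, mul_smul_comm, h₂]
  rw [smul_smul, smul_smul, inv_mul_cancel₀ hc, one_mul]

theorem GroupInvertible.map {B F : Type*} [Semiring B] [FunLike F A B] [MulHomClass F A B] (f : F)
    {a : A} (ha : GroupInvertible a) : GroupInvertible (f a) := by
  obtain ⟨s, h₁, h₂⟩ := ha
  exact ⟨f s, h₁.map f, by rw [← map_mul, ← map_mul, h₂]⟩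

variable (K) in
/-- The space `aAb`. -/
def corner (a b : A) : Submodule K A :=
  LinearMap.range (LinearMap.mulLeft K a ∘ₗ LinearMap.mulRight K b)

theorem mem_corner {a b x : A} : x ∈ corner K a b ↔ ∃ h, a * h * b = x := by
  simp [corner, mul_assoc]

theorem corner_smul {a b : A} {c d : K} (hc : c ≠ 0) (hd : d ≠ 0) :
    corner K (c • a) (d • b) = corner K a b := by
  ext x
  simp only [mem_corner]
  constructor
  · rintro ⟨h, rfl⟩
    exact ⟨(c * d) • h, by simp [smul_smul, mul_comm]⟩
  · rintro ⟨h, rfl⟩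
    refine ⟨(c * d)⁻¹ • h, ?_⟩
    simp only [smul_mul_assoc, mul_smul_comm, smul_smul]
    rw [show d * ((c * d)⁻¹ * c) = 1 by field_simp, one_smul]

instance [Module.Finite K A] (a b : A) : Module.Finite K (corner K a b) :=
  inferInstanceAs (Module.Finite K (LinearMap.range _))

/-- The map `g` only witnesses injectivity of `f` on the corner, so it need not be linear. -/
theorem finrank_corner_le [Module.Finite K A] {a b a' b' : A} (f : A →ₗ[K] A) (g : A → A)
    (hf : ∀ h, f (a * h * b) ∈ corner K a' b') (hg : ∀ h, g (f (a * h * b)) = a * h * b) :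
    Module.finrank K (corner K a b) ≤ Module.finrank K (corner K a' b') := by
  refine LinearMap.finrank_le_finrank_of_injective (f := f.restrict (p := corner K a b)
    (q := corner K a' b') ?_) ?_
  · intro x hx
    obtain ⟨h, rfl⟩ := mem_corner.mp hx
    exact hf h
  · rintro ⟨x, hx⟩ ⟨y, hy⟩ hxy
    obtain ⟨h, rfl⟩ := mem_corner.mp hx
    obtain ⟨k, rfl⟩ := mem_corner.mp hy
    have : f (a * h * b) = f (a * k * b) := congrArg Subtype.val hxy
    exact Subtype.ext ((hg h).symm.trans ((congrArg g this).trans (hg k)))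

/-- Homomorphisms between `Aa` and `Ab` for a group invertible `a`. -/
theorem finrank_hom_span {a : A} (ha : GroupInvertible a) (b : A) :
    Module.finrank K (Submodule.span A {a} →ₗ[A] Submodule.span A {b}) =
      Module.finrank K (corner K a b) := by
  have ma : a ∈ Submodule.span A {a} := Submodule.mem_span_singleton_self a
  let Φ : (Submodule.span A {a} →ₗ[A] Submodule.span A {b}) →ₗ[K] A :=
    { toFun := fun f => f ⟨a, ma⟩
      map_add' := fun f g => rfl
      map_smul' := fun c f => rfl }
  have hinj : Function.Injective Φ := by
    intro f g hfg
    ext ⟨x, hx⟩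
    obtain ⟨c, rfl⟩ := Submodule.mem_span_singleton.mp hx
    have e : (⟨c • a, hx⟩ : Submodule.span A {a}) = c • ⟨a, ma⟩ := rfl
    have hfg' : (f ⟨a, ma⟩ : A) = g ⟨a, ma⟩ := hfg
    rw [e, map_smul, map_smul, Submodule.coe_smul, Submodule.coe_smul, hfg']
  have hrange : LinearMap.range Φ = corner K a b := by
    ext x
    rw [mem_corner, LinearMap.mem_range]
    constructor
    · rintro ⟨f, rfl⟩
      obtain ⟨s, h₁, h₂⟩ := ha
      obtain ⟨k, hk⟩ := Submodule.mem_span_singleton.mp (f ⟨a, ma⟩).2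
      refine ⟨s * k, ?_⟩
      -- Since `a = (a s) a`, linearity gives `f(a) = a s f(a)`, which lies in `aAb`.
      have e : (⟨a, ma⟩ : Submodule.span A {a}) = (a * s) • ⟨a, ma⟩ := by
        apply Subtype.ext
        change a = a * s * a
        rw [mul_assoc, ← h₁.eq, ← mul_assoc, h₂]
      change _ = (f ⟨a, ma⟩ : A)
      rw [e, map_smul, Submodule.coe_smul, ← hk]
      simp only [smul_eq_mul, mul_assoc]
    · rintro ⟨h, rfl⟩
      refine ⟨((LinearMap.toSpanSingleton A A (h * b)).domRestrict _).codRestrict _ ?_, ?_⟩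
      · rintro ⟨x, hx⟩
        refine Submodule.mem_span_singleton.mpr ⟨x * h, ?_⟩
        simp [mul_assoc]
      · change a * (h * b) = _
        rw [mul_assoc]
  rw [← hrange]
  exact (LinearEquiv.ofInjective Φ hinj).finrank_eq

/-- The map `z ↦ y z x'` is injective on the corner: multiplying by `x` and `y'` produces `(xy) z
(x'y')`, and `s` and `t` undo these factors. -/
theorem finrank_corner_swap_le [Module.Finite K A] {x y x' y' : A}
    (h : GroupInvertible (x * y)) (h' : GroupInvertible (x' * y')) :
    Module.finrank K (corner K (x * y) (x' * y')) ≤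
      Module.finrank K (corner K (y * x) (y' * x')) := by
  obtain ⟨s, h₁, h₂⟩ := h
  obtain ⟨t, h₁', h₂'⟩ := h'
  refine finrank_corner_le (LinearMap.mulLeft K y ∘ₗ LinearMap.mulRight K x')
    (fun z => s * (x * z * y') * t) (fun k => mem_corner.mpr ⟨y * k * x', ?_⟩) fun k => ?_
  · simp only [LinearMap.comp_apply, LinearMap.mulLeft_apply, LinearMap.mulRight_apply, mul_assoc]
  · simp only [LinearMap.comp_apply, LinearMap.mulLeft_apply, LinearMap.mulRight_apply]
    calc s * (x * (y * (x * y * k * (x' * y') * x')) * y') * t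
        = s * (x * y) * (x * y) * k * (x' * y' * (x' * y') * t) := by simp only [mul_assoc]
      _ = x * y * k * (x' * y') := by
        rw [← h₁.eq, mul_assoc (x * y) s, ← h₁.eq, ← mul_assoc (x * y) (x * y) s, h₂, h₂']

theorem finrank_corner_swap [Module.Finite K A] {x y x' y' : A}
    (h : GroupInvertible (x * y)) (h' : GroupInvertible (x' * y'))
    (hs : GroupInvertible (y * x)) (hs' : GroupInvertible (y' * x')) :
    Module.finrank K (corner K (x * y) (x' * y')) =
      Module.finrank K (corner K (y * x) (y' * x')) :=
  le_antisymm (finrank_corner_swap_le h h') (finrank_corner_swap_le hs hs')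

/-- The pairing `(z, k) ↦ L(zk)` embeds `aAb` into the dual of `bA n(a)`. -/
theorem finrank_corner_le_of_form [Module.Finite K A] (L : A →ₗ[K] K) (n : A →ₐ[K] A)
    (hL : ∀ g h, L (g * h) = L (h * n g)) (nondeg : ∀ x y, (∀ k, L (x * k) = L (y * k)) → x = y)
    {a b : A} (ha : GroupInvertible a) (hb : GroupInvertible b) :
    Module.finrank K (corner K a b) ≤ Module.finrank K (corner K b (n a)) := by
  let f : corner K a b →ₗ[K] Module.Dual K (corner K b (n a)) :=
    LinearMap.mk₂ K (fun z k => L ((z : A) * k)) (fun _ _ _ => by simp [add_mul])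
      (fun _ _ _ => by simp) (fun _ _ _ => by simp [mul_add]) (fun _ _ _ => by simp)
  have hf : Function.Injective f := by
    obtain ⟨s, h₁, h₂⟩ := ha
    obtain ⟨t, h₁', h₂'⟩ := hb
    have h₁'' : n a * n s = n s * n a := by rw [← map_mul, h₁.eq, map_mul]
    -- Against `z ∈ aAb` an arbitrary `m` may be replaced by an element of `bA n(a)`: `b = b² t`
    -- supplies the left factor, and `a = a² s` lets `a` and `s` move through `L` to the right end
    -- as `n s * n a`.
    have key : ∀ z ∈ corner K a b, ∀ m, L (z * m) = L (z * (b * (t * m * n s) * n a)) := by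
      intro z hz m
      obtain ⟨h, rfl⟩ := mem_corner.mp hz
      calc L (a * h * b * m) = L (a * (s * (a * h * b * b * t * m))) := by
            congr 1
            calc a * h * b * m = (a * a * s) * h * (b * b * t) * m := by rw [h₂, h₂']
              _ = a * (a * s) * h * (b * b * t) * m := by simp only [mul_assoc]
              _ = _ := by rw [h₁.eq]; simp only [mul_assoc]
        _ = L (a * h * b * b * t * m * (n s * n a)) := by
          rw [hL, mul_assoc s, hL, mul_assoc _ (n a), h₁'']
        _ = _ := by simp only [mul_assoc]
    rintro ⟨x, hx⟩ ⟨y, hy⟩ hxy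
    refine Subtype.ext (nondeg x y fun m => ?_)
    rw [key x hx, key y hy]
    exact LinearMap.congr_fun hxy ⟨_, mem_corner.mpr ⟨t * m * n s, rfl⟩⟩
  let _ : AddCommGroup (corner K b (n a)) := Module.addCommMonoidToAddCommGroup K
  rw [← Subspace.dual_finrank_eq (K := K) (V := corner K b (n a))]
  exact LinearMap.finrank_le_finrank_of_injective hf

theorem finrank_corner_map_le [Module.Finite K A] (n : A →ₐ[K] A) (g : A → A)
    (hg : ∀ a, g (n a) = a) (a b : A) :
    Module.finrank K (corner K a b) ≤ Module.finrank K (corner K (n a) (n b)) :=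
  finrank_corner_le n.toLinearMap g (fun h => mem_corner.mpr ⟨n h, by simp⟩) fun h => hg _

end GroupInvertible

section Symmetries

variable {r : ℕ}

/-! ### Two automorphisms -/

theorem opi_mul_self_add (i : Fin (r - 1)) : opi i * opi i + opi i = 0 := by
  nth_rw 3 [← one_smul ℂ (opi i)]
  rw [opi_mul_self, ← add_smul, neg_add_cancel, zero_smul]

theorem opi_mul_pi (i : Fin (r - 1)) : opi i * pi i = 0 := by
  rw [pi, mul_add, mul_one, opi_mul_self_add]

theorem pi_mul_self (i : Fin (r - 1)) : pi i * pi i = pi i := by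
  nth_rw 1 [pi]
  rw [add_mul, opi_mul_pi, one_mul, zero_add]

theorem pi_braid (i j : Fin (r - 1)) (h : (i : ℕ) + 1 = j) :
    pi i * pi j * pi i = pi j * pi i * pi j := by
  have e : ∀ a b : Hecke r, a * a + a = 0 →
      (a + 1) * (b + 1) * (a + 1) = a * b * a + (a * b + b * a + a + b + 1) := by
    intro a b ha
    calc (a + 1) * (b + 1) * (a + 1)
        = a * b * a + (a * b + b * a + (a * a + a) + a + b + 1) := by
          simp only [mul_add, add_mul, mul_one, one_mul]; abel
      _ = _ := by rw [ha, add_zero]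
  rw [pi, pi, e _ _ (opi_mul_self_add i), e _ _ (opi_mul_self_add j), opi_braid i j h]
  abel

theorem pi_comm (i j : Fin (r - 1)) (h : (i : ℕ) + 2 ≤ j ∨ (j : ℕ) + 2 ≤ i) :
    pi i * pi j = pi j * pi i := by
  simp only [pi, mul_add, add_mul, mul_one, one_mul, opi_comm i j h]
  abel

/-- The automorphism `π̄_i ↦ -π_i`. -/
def negAut (r : ℕ) : Hecke r →ₐ[ℂ] Hecke r :=
  lift (fun i => (-1 : ℂ) • pi i)
    (fun i => by simp only [smul_mul_assoc, mul_smul_comm, pi_mul_self])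
    (fun i j h => by simp only [smul_mul_assoc, mul_smul_comm, pi_braid i j h])
    (fun i j h => by simp only [smul_mul_assoc, mul_smul_comm, pi_comm i j h])

@[simp] theorem negAut_opi (i : Fin (r - 1)) : negAut r (opi i) = (-1 : ℂ) • pi i := by
  simp [negAut]

@[simp] theorem negAut_pi (i : Fin (r - 1)) : negAut r (pi i) = (-1 : ℂ) • opi i := by
  have : (-1 : ℂ) • opi i + ((-1 : ℂ) • (1 : Hecke r) + (1 : ℂ) • 1) = (-1 : ℂ) • opi i := by
    rw [← add_smul, neg_add_cancel, zero_smul, add_zero]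
  rw [one_smul] at this
  rw [pi, map_add, map_one, negAut_opi, pi, smul_add, add_assoc, this]

@[simp] theorem negAut_negAut (h : Hecke r) : negAut r (negAut r h) = h := by
  have : (negAut r).comp (negAut r) = AlgHom.id ℂ _ := algHom_ext fun i => by
    simp [smul_smul]
  exact DFunLike.congr_fun this h

/-- The automorphism `π̄_i ↦ π̄_{r-i}`. -/
def revAut (r : ℕ) : Hecke r →ₐ[ℂ] Hecke r :=
  lift (fun i => opi i.rev) (fun i => opi_mul_self _)
    (fun i j h => (opi_braid j.rev i.rev (by rw [Fin.val_rev, Fin.val_rev]; omega)).symm)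
    (fun i j h => opi_comm _ _ (by rw [Fin.val_rev, Fin.val_rev]; omega))

@[simp] theorem revAut_opi (i : Fin (r - 1)) : revAut r (opi i) = opi i.rev := by
  simp [revAut]

@[simp] theorem revAut_pi (i : Fin (r - 1)) : revAut r (pi i) = pi i.rev := by
  simp [pi]

/-! ### Products over words -/

theorem list_prod_map_smul {ι A : Type*} [Semiring A] [Algebra ℂ A] (c : ℂ) (f : ι → A)
    (l : List ι) : (l.map fun i => c • f i).prod = c ^ l.length • (l.map f).prod := by
  induction l with
  | nil => simp
  | cons i l ih =>
    rw [List.map_cons, List.prod_cons, ih, List.map_cons, List.prod_cons, List.length_cons,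
      smul_mul_smul_comm, pow_succ']

theorem mul_list_prod_of_forall {ι A : Type*} [Semiring A] [Algebra ℂ A] {c : ℂ} {f : ι → A}
    {l : List ι} {z : A} (h : ∀ i ∈ l, z * f i = c • z) :
    z * (l.map f).prod = c ^ l.length • z := by
  induction l with
  | nil => simp
  | cons i l ih =>
    rw [List.map_cons, List.prod_cons, ← mul_assoc, h i (by simp), smul_mul_assoc,
      ih fun j hj => h j (by simp [hj]), smul_smul, List.length_cons, pow_succ']

theorem list_prod_mul_of_forall {ι A : Type*} [Semiring A] [Algebra ℂ A] {c : ℂ} {f : ι → A}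
    {l : List ι} {z : A} (h : ∀ i ∈ l, f i * z = c • z) :
    (l.map f).prod * z = c ^ l.length • z := by
  induction l with
  | nil => simp
  | cons i l ih =>
    rw [List.map_cons, List.prod_cons, mul_assoc, ih fun j hj => h j (by simp [hj]),
      mul_smul_comm, h i (by simp), smul_smul, List.length_cons, pow_succ]

theorem negAut_opiPerm (w : Equiv.Perm (Fin r)) :
    negAut r (opiPerm w) = (-1 : ℂ) ^ (reducedWord w).length • piPerm w := by
  rw [opiPerm, piPerm, ← list_prod_map_smul, map_list_prod, List.map_map]
  congr 2
  funext i
  simp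

theorem negAut_piPerm (w : Equiv.Perm (Fin r)) :
    negAut r (piPerm w) = (-1 : ℂ) ^ (reducedWord w).length • opiPerm w := by
  rw [opiPerm, piPerm, ← list_prod_map_smul, map_list_prod, List.map_map]
  congr 2
  funext i
  simp

/-! ### The elements `π̄_{w₀(S)}` and `π_{w₀(S)}` -/

/-- `π̄_{w₀(S)}`. -/
def opiLong (S : Finset (Fin (r - 1))) : Hecke r := opiPerm (longest S)

/-- `π_{w₀(S)}`. -/
def piLong (S : Finset (Fin (r - 1))) : Hecke r := piPerm (longest S)

/-- The sign of `w₀(S)`. -/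
def longSign (S : Finset (Fin (r - 1))) : ℂ := (-1) ^ (reducedWord (longest S)).length

theorem longSign_ne_zero (S : Finset (Fin (r - 1))) : longSign S ≠ 0 :=
  pow_ne_zero _ (by norm_num)

theorem negAut_opiLong (S : Finset (Fin (r - 1))) :
    negAut r (opiLong S) = longSign S • piLong S := negAut_opiPerm _

theorem negAut_piLong (S : Finset (Fin (r - 1))) :
    negAut r (piLong S) = longSign S • opiLong S := negAut_piPerm _

theorem opiLong_mul_opi {S : Finset (Fin (r - 1))} {i : Fin (r - 1)} (hi : i ∈ S) :
    opiLong S * opi i = (-1 : ℂ) • opiLong S :=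
  opiPerm_mul_opi_of_desc (desc_longest hi)

theorem opi_mul_opiLong {S : Finset (Fin (r - 1))} {i : Fin (r - 1)} (hi : i ∈ S) :
    opi i * opiLong S = (-1 : ℂ) • opiLong S := by
  have h := congrArg (flip r) (opiPerm_mul_opi_of_desc (desc_inv_longest hi))
  rwa [flip_mul, map_smul, flip_opi, flip_opiPerm, inv_inv] at h

/-- The image of `opiLong_mul_opi` under `negAut`, with the nonzero scalars cancelled. -/
theorem piLong_mul_pi {S : Finset (Fin (r - 1))} {i : Fin (r - 1)} (hi : i ∈ S) :
    piLong S * pi i = (1 : ℂ) • piLong S := by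
  have h := congrArg (negAut r) (opiLong_mul_opi hi)
  rw [map_mul, map_smul, negAut_opiLong, negAut_opi, smul_mul_smul_comm, smul_smul] at h
  rw [mul_comm] at h
  rw [one_smul]
  exact smul_right_injective _ (mul_ne_zero (by norm_num) (longSign_ne_zero S)) h

theorem pi_mul_piLong {S : Finset (Fin (r - 1))} {i : Fin (r - 1)} (hi : i ∈ S) :
    pi i * piLong S = (1 : ℂ) • piLong S := by
  have h := congrArg (negAut r) (opi_mul_opiLong hi)
  rw [map_mul, map_smul, negAut_opiLong, negAut_opi, smul_mul_smul_comm, smul_smul] at h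
  rw [one_smul]
  exact smul_right_injective _ (mul_ne_zero (by norm_num) (longSign_ne_zero S)) h

theorem opi_mul_piLong {S : Finset (Fin (r - 1))} {i : Fin (r - 1)} (hi : i ∈ S) :
    opi i * piLong S = 0 := by
  rw [← one_smul ℂ (piLong S), ← pi_mul_piLong hi, ← mul_assoc, opi_mul_pi, zero_mul]

/-- An element absorbing the `f i`, `i ∈ S`, that is itself a product of such elements is unique
up to a scalar. -/
theorem absorbing_unique {ι A : Type*} [Semiring A] [Algebra ℂ A] {c : ℂ} {f : ι → A}
    {l l' : List ι} (h : ∀ i ∈ l', (l.map f).prod * f i = c • (l.map f).prod)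
    (h' : ∀ i ∈ l, f i * (l'.map f).prod = c • (l'.map f).prod) :
    c ^ l'.length • (l.map f).prod = c ^ l.length • (l'.map f).prod := by
  rw [← mul_list_prod_of_forall h, ← list_prod_mul_of_forall h']

/-- The reversed word again gives an absorbing product, so `absorbing_unique` applies and it is not
necessary to know that `w₀(S)` is an involution. -/
theorem flip_opiLong (S : Finset (Fin (r - 1))) : flip r (opiLong S) = opiLong S := by
  have e : flip r (opiLong S) = ((reducedWord (longest S)).reverse.map opi).prod :=
    flip_list_prod _ flip_opi _
  have h := absorbing_unique (c := (-1 : ℂ)) (f := opi) (l := reducedWord (longest S))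
    (l' := (reducedWord (longest S)).reverse)
    (fun i hi => opiLong_mul_opi (mem_of_mem_reducedWord_longest i (List.mem_reverse.mp hi)))
    (fun i hi => by
      have := congrArg (flip r) (opiLong_mul_opi (mem_of_mem_reducedWord_longest i hi))
      rwa [flip_mul, map_smul, flip_opi, e] at this)
  rw [List.length_reverse] at h
  rw [e]
  exact (smul_right_injective _ (longSign_ne_zero S) h).symm

theorem flip_piLong (S : Finset (Fin (r - 1))) : flip r (piLong S) = piLong S := by
  have e : flip r (piLong S) = ((reducedWord (longest S)).reverse.map pi).prod :=
    flip_list_prod _ flip_pi _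
  have h := absorbing_unique (c := (1 : ℂ)) (f := pi) (l := reducedWord (longest S))
    (l' := (reducedWord (longest S)).reverse)
    (fun i hi => piLong_mul_pi (mem_of_mem_reducedWord_longest i (List.mem_reverse.mp hi)))
    (fun i hi => by
      have := congrArg (flip r) (piLong_mul_pi (mem_of_mem_reducedWord_longest i hi))
      rwa [flip_mul, map_smul, flip_pi, e] at this)
  rw [one_pow, one_pow, one_smul, one_smul] at h
  rw [e]
  exact h.symm

/-- Both sides absorb the generators indexed by `T`. The two signs are not compared, since corners
are insensitive to nonzero scalars. -/
theorem revAut_opiLong {S T : Finset (Fin (r - 1))} (hST : ∀ i, i.rev ∈ T ↔ i ∈ S) :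
    longSign T • revAut r (opiLong S) = longSign S • opiLong T := by
  have e : revAut r (opiLong S) = (((reducedWord (longest S)).map Fin.rev).map opi).prod := by
    rw [opiLong, opiPerm, map_list_prod, List.map_map, List.map_map]
    congr 2
    funext i
    simp
  have h := absorbing_unique (c := (-1 : ℂ)) (f := opi)
    (l := (reducedWord (longest S)).map Fin.rev) (l' := reducedWord (longest T))
    (fun i hi => by
      have hi' : i.rev ∈ S := by
        rw [← hST, Fin.rev_rev]; exact mem_of_mem_reducedWord_longest i hi
      have := congrArg (revAut r) (opiLong_mul_opi hi')
      rwa [map_mul, map_smul, revAut_opi, Fin.rev_rev, e] at this)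
    (fun i hi => by
      obtain ⟨j, hj, rfl⟩ := List.mem_map.mp hi
      exact opi_mul_opiLong ((hST j).mpr (mem_of_mem_reducedWord_longest j hj)))
  rw [List.length_map] at h
  rw [e]
  exact h

theorem revAut_piLong {S T : Finset (Fin (r - 1))} (hST : ∀ i, i.rev ∈ T ↔ i ∈ S) :
    revAut r (piLong S) = piLong T := by
  have e : revAut r (piLong S) = (((reducedWord (longest S)).map Fin.rev).map pi).prod := by
    rw [piLong, piPerm, map_list_prod, List.map_map, List.map_map]
    congr 2
    funext i
    simp
  have h := absorbing_unique (c := (1 : ℂ)) (f := pi)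
    (l := (reducedWord (longest S)).map Fin.rev) (l' := reducedWord (longest T))
    (fun i hi => by
      have hi' : i.rev ∈ S := by
        rw [← hST, Fin.rev_rev]; exact mem_of_mem_reducedWord_longest i hi
      have := congrArg (revAut r) (piLong_mul_pi hi')
      rwa [map_mul, map_smul, revAut_pi, Fin.rev_rev, e] at this)
    (fun i hi => by
      obtain ⟨j, hj, rfl⟩ := List.mem_map.mp hi
      exact pi_mul_piLong ((hST j).mpr (mem_of_mem_reducedWord_longest j hj)))
  rw [one_pow, one_pow, one_smul, one_smul] at h
  rw [e]
  exact h

/-! ### Leading terms and group invertibility of the generators of `R_α` -/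

/-- All terms of `m` have length at least `n`. -/
def Low (n : ℕ) (m : Hecke r) : Prop := ∀ u, inv u < n → coeff u m = 0

theorem Low.mul_opi {n : ℕ} {m : Hecke r} (h : Low n m) (i : Fin (r - 1)) : Low n (m * opi i) := by
  intro u hu
  rw [coeff_mul_opi]
  split_ifs with hd
  · have := inv_mul_simpleTransposition_of_desc hd
    rw [h u hu, h _ (by omega), sub_zero]
  · rfl

theorem Low.mul_pi {n : ℕ} {m : Hecke r} (h : Low n m) (i : Fin (r - 1)) : Low n (m * pi i) := by
  intro u hu
  rw [pi, mul_add, mul_one, map_add, h.mul_opi i u hu, h u hu, add_zero]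

theorem Low.mul_piLong {n : ℕ} {m : Hecke r} (h : Low n m) (S : Finset (Fin (r - 1))) :
    Low n (m * piLong S) := by
  rw [piLong, piPerm]
  induction reducedWord (longest S) generalizing m with
  | nil => simpa using h
  | cons i l ih => rw [List.map_cons, List.prod_cons, ← mul_assoc]; exact ih (h.mul_pi i)

/-- Each letter is a descent `i` of `v` and contributes `-1`: the other contribution, from the
shorter `v s_i`, vanishes by `Low`. -/
theorem coeff_mul_opiLong {v : Equiv.Perm (Fin r)} {m : Hecke r} (h : Low (inv v) m)
    {S : Finset (Fin (r - 1))} (hS : ∀ i ∈ S, Desc v i) :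
    coeff v (m * opiLong S) = longSign S * coeff v m := by
  have hl : ∀ i ∈ reducedWord (longest S), Desc v i := fun i hi =>
    hS i (mem_of_mem_reducedWord_longest i hi)
  rw [opiLong, opiPerm, longSign]
  generalize reducedWord (longest S) = l at hl
  induction l generalizing m with
  | nil => simp
  | cons i l ih =>
    have hd := hl i (by simp)
    have := inv_mul_simpleTransposition_of_desc hd
    rw [List.map_cons, List.prod_cons, ← mul_assoc, 
      ih (h.mul_opi i) fun j hj => hl j (by simp [hj]), coeff_mul_opi, if_pos hd,
      h _ (by omega), List.length_cons, pow_succ]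
    ring

theorem coeff_mul_piLong {v : Equiv.Perm (Fin r)} {m : Hecke r} (h : Low (inv v) m)
    {S : Finset (Fin (r - 1))} (hS : ∀ i ∈ S, ¬ Desc v i) :
    coeff v (m * piLong S) = coeff v m := by
  have hl : ∀ i ∈ reducedWord (longest S), ¬ Desc v i := fun i hi =>
    hS i (mem_of_mem_reducedWord_longest i hi)
  rw [piLong, piPerm]
  generalize reducedWord (longest S) = l at hl
  induction l generalizing m with
  | nil => simp
  | cons i l ih =>
    rw [List.map_cons, List.prod_cons, ← mul_assoc, 
      ih (h.mul_pi i) fun j hj => hl j (by simp [hj]), coeff_mul_pi, if_neg (hl i (by simp))]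

/-- The descent set of `v`. -/
def descents (v : Equiv.Perm (Fin r)) : Finset (Fin (r - 1)) := Finset.univ.filter (Desc v)

theorem mem_descents {v : Equiv.Perm (Fin r)} {i : Fin (r - 1)} : i ∈ descents v ↔ Desc v i := by
  simp [descents]

/-- The part of `m` supported on the permutations with descent set `S`. -/
def descPart (S : Finset (Fin (r - 1))) (m : Hecke r) : Hecke r :=
  ∑ v, (if descents v = S then coeff v m else 0) • opiPerm v

theorem coeff_descPart (S : Finset (Fin (r - 1))) (m : Hecke r) (v : Equiv.Perm (Fin r)) :
    coeff v (descPart S m) = if descents v = S then coeff v m else 0 := by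
  rw [descPart, map_sum, Finset.sum_eq_single v]
  · rw [map_smul, coeff_opiPerm, if_pos rfl, smul_eq_mul, mul_one]
  · intro w _ hw
    rw [map_smul, coeff_opiPerm, if_neg hw, smul_zero]
  · simp

theorem exists_coeff_ne_zero_low {m : Hecke r} (hm : m ≠ 0) :
    ∃ v, coeff v m ≠ 0 ∧ Low (inv v) m := by
  have hne : (Finset.univ.filter fun v : Equiv.Perm (Fin r) => coeff v m ≠ 0).Nonempty := by
    by_contra hc
    rw [Finset.not_nonempty_iff_eq_empty, Finset.filter_eq_empty_iff] at hc
    exact hm (eq_zero_of_coeff fun v => by simpa using hc (Finset.mem_univ v))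
  obtain ⟨v, hv, hmin⟩ := Finset.exists_min_image _ inv hne
  refine ⟨v, by simpa using hv, fun u hu => ?_⟩
  by_contra hc
  exact not_le.mpr hu (hmin u (by simpa using hc))

theorem sum_coeff_smul (m : Hecke r) : ∑ v, coeff v m • opiPerm v = m := by
  simpa [coeff] using (stdBasis r).sum_repr m

/-- The hypothesis kills the coefficients of `m` at every `v` lacking a descent in `S`. If `v` has a
descent `i ∉ S`, then `π̄_v = -π̄_v π̄_i` is annihilated by `piLong Sᶜ`. Only the `v` with descent
set exactly `S` remain. -/
theorem descPart_mul_piLong {S : Finset (Fin (r - 1))} {m : Hecke r}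
    (hm : ∀ i ∈ S, m * opi i = (-1 : ℂ) • m) : descPart S m * piLong Sᶜ = m * piLong Sᶜ := by
  conv_rhs => rw [← sum_coeff_smul m]
  rw [descPart, Finset.sum_mul, Finset.sum_mul]
  refine Finset.sum_congr rfl fun v _ => ?_
  split_ifs with hv
  · rfl
  rw [zero_smul, zero_mul]
  by_cases hsub : S ⊆ descents v
  · obtain ⟨i, hi, hiS⟩ := Finset.not_subset.mp fun h => hv (Finset.Subset.antisymm h hsub)
    have h₁ := opiPerm_mul_opi_of_desc (mem_descents.mp hi)
    have h₂ : opiPerm v * piLong Sᶜ = 0 := by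
      have : (-1 : ℂ) • (opiPerm v * piLong Sᶜ) = 0 := by
        rw [← smul_mul_assoc, ← h₁, mul_assoc, opi_mul_piLong (Finset.mem_compl.mpr hiS), mul_zero]
      simpa using this
    rw [smul_mul_assoc, h₂, smul_zero]
  · obtain ⟨i, hiS, hi⟩ := Finset.not_subset.mp hsub
    have h₁ := congrArg (coeff v) (hm i hiS)
    rw [coeff_mul_opi, if_neg (mem_descents.not.mp hi), map_smul, smul_eq_mul, neg_one_mul,
      eq_comm, neg_eq_zero] at h₁
    rw [h₁, zero_smul, zero_mul]

/-- The generator of `R_α` for `set(α) = S`. -/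
def gen (S : Finset (Fin (r - 1))) : Hecke r := opiLong S * piLong Sᶜ

/-- The product of the factors of `gen S` in the opposite order. -/
def revGen (S : Finset (Fin (r - 1))) : Hecke r := piLong Sᶜ * opiLong S

theorem mul_opiLong_mul_opi {S : Finset (Fin (r - 1))} (h : Hecke r) :
    ∀ i ∈ S, h * opiLong S * opi i = (-1 : ℂ) • (h * opiLong S) := fun i hi => by
  rw [mul_assoc, opiLong_mul_opi hi, mul_smul_comm]

/-- A shortest term of `descPart S m` has no descent in `Sᶜ`, so its coefficient survives
multiplication by `piLong Sᶜ`. -/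
theorem descPart_eq_zero {S : Finset (Fin (r - 1))} {m : Hecke r}
    (hm : ∀ i ∈ S, m * opi i = (-1 : ℂ) • m) (h : m * piLong Sᶜ = 0) : descPart S m = 0 := by
  by_contra hne
  obtain ⟨v, hv, hlow⟩ := exists_coeff_ne_zero_low hne
  have hd : descents v = S := by
    by_contra hd
    exact hv (by rw [coeff_descPart, if_neg hd])
  apply hv
  rw [← coeff_mul_piLong (S := Sᶜ) hlow fun i hi => by
    rw [← mem_descents, hd]; exact Finset.mem_compl.mp hi]
  rw [descPart_mul_piLong hm, h, map_zero]

/-- With `m = h * opiLong S`, the product `h * gen S` depends only on `descPart S m`. A shortest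
term of that part would survive, up to sign, in the `S`-part of `m * piLong Sᶜ * opiLong S`, which
vanishes by `descPart_eq_zero`. -/
theorem mul_gen_eq_zero {S : Finset (Fin (r - 1))} {h : Hecke r} (hh : h * gen S * gen S = 0) :
    h * gen S = 0 := by
  have hm := mul_opiLong_mul_opi (S := S) h
  have hm' := mul_opiLong_mul_opi (S := S) (h * opiLong S * piLong Sᶜ)
  have h₀ : descPart S (h * opiLong S * piLong Sᶜ * opiLong S) = 0 :=
    descPart_eq_zero hm' (by simpa [gen, mul_assoc] using hh)
  have h₁ : descPart S (h * opiLong S) = 0 := by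
    by_contra hne
    obtain ⟨v, hv, hlow⟩ := exists_coeff_ne_zero_low hne
    have hd : descents v = S := by
      by_contra hd
      exact hv (by rw [coeff_descPart, if_neg hd])
    have e₁ := coeff_mul_opiLong (S := S) (hlow.mul_piLong Sᶜ) fun i hi => by
      rwa [← mem_descents, hd]
    rw [coeff_mul_piLong hlow fun i hi => by
      rw [← mem_descents, hd]; exact Finset.mem_compl.mp hi] at e₁
    rw [descPart_mul_piLong hm] at e₁
    have e₂ := congrArg (coeff v) h₀
    rw [coeff_descPart, if_pos hd, e₁, map_zero] at e₂
    exact mul_ne_zero (longSign_ne_zero S) hv e₂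
  rw [gen, ← mul_assoc, ← descPart_mul_piLong hm, h₁, zero_mul]

theorem groupInvertible_gen (S : Finset (Fin (r - 1))) : GroupInvertible (gen S) :=
  groupInvertible_of_mul_right ℂ fun _ => mul_gen_eq_zero

theorem negAut_gen (S : Finset (Fin (r - 1))) :
    negAut r (gen Sᶜ) = (longSign Sᶜ * longSign S) • revGen S := by
  rw [gen, map_mul, negAut_opiLong, negAut_piLong, compl_compl, smul_mul_smul_comm, revGen]

theorem groupInvertible_revGen (S : Finset (Fin (r - 1))) : GroupInvertible (revGen S) := by
  have hc : longSign Sᶜ * longSign S ≠ 0 := mul_ne_zero (longSign_ne_zero _) (longSign_ne_zero _)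
  have := ((groupInvertible_gen Sᶜ).map (negAut r)).smul (inv_ne_zero hc)
  rwa [negAut_gen, smul_smul, inv_mul_cancel₀ hc, one_smul] at this

theorem flip_gen (S : Finset (Fin (r - 1))) : flip r (gen S) = revGen S := by
  rw [gen, flip_mul, flip_opiLong, flip_piLong, revGen]

theorem revAut_gen {S T : Finset (Fin (r - 1))} (hST : ∀ i, i.rev ∈ T ↔ i ∈ S) :
    ∃ c : ℂ, c ≠ 0 ∧ revAut r (gen S) = c • gen T := by
  refine ⟨(longSign T)⁻¹ * longSign S,
    mul_ne_zero (inv_ne_zero (longSign_ne_zero T)) (longSign_ne_zero S), ?_⟩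
  have h₁ : revAut r (opiLong S) = ((longSign T)⁻¹ * longSign S) • opiLong T := by
    rw [← smul_smul, ← revAut_opiLong hST, smul_smul, inv_mul_cancel₀ (longSign_ne_zero T),
      one_smul]
  have h₂ : revAut r (piLong Sᶜ) = piLong Tᶜ := revAut_piLong fun i => by
    rw [Finset.mem_compl, Finset.mem_compl, hST]
  rw [gen, map_mul, h₁, h₂, smul_mul_assoc, gen]

/-! ### The Frobenius form -/

theorem simpleTransposition_mul_revPerm (i : Fin (r - 1)) :
    simpleTransposition i * Fin.revPerm = Fin.revPerm * simpleTransposition i.rev := by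
  have h₁ : Fin.revPerm (lo i.rev) = hi i := by
    simp only [Fin.revPerm_apply, Fin.ext_iff, Fin.val_rev, val_lo, val_hi]; omega
  have h₂ : Fin.revPerm (hi i.rev) = lo i := by
    simp only [Fin.revPerm_apply, Fin.ext_iff, Fin.val_rev, val_lo, val_hi]; omega
  rw [simpleTransposition_eq, simpleTransposition_eq, Equiv.mul_swap_eq_swap_mul, h₁, h₂,
    Equiv.swap_comm]

theorem revPerm_inv : (Fin.revPerm : Equiv.Perm (Fin r))⁻¹ = Fin.revPerm := by
  rw [inv_eq_iff_mul_eq_one]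
  ext; simp

/-- The Frobenius form: the coefficient of `π̄_{w₀}`. -/
def frob (r : ℕ) : Hecke r →ₗ[ℂ] ℂ := coeff Fin.revPerm

/-- Flipping, which preserves the coefficient at the involution `w₀`, turns left into right
multiplication; then `s_i w₀ = w₀ s_{r-i}` identifies the two coefficient formulas. -/
theorem frob_opi_mul (i : Fin (r - 1)) (h : Hecke r) :
    frob r (opi i * h) = frob r (h * opi i.rev) := by
  have h₁ : frob r (opi i * h) = frob r (flip r h * opi i) := by
    rw [frob, ← revPerm_inv, ← coeff_flip, revPerm_inv, flip_mul, flip_opi]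
  rw [h₁, frob, coeff_mul_opi, coeff_mul_opi, if_pos (desc_revPerm _), if_pos (desc_revPerm _),
    coeff_flip, coeff_flip, mul_inv_rev, revPerm_inv, simpleTransposition_inv,
    simpleTransposition_mul_revPerm]

theorem frob_mul (g h : Hecke r) : frob r (g * h) = frob r (h * revAut r g) := by
  induction g using hecke_induction generalizing h with
  | algebraMap c => rw [AlgHom.commutes, Algebra.commutes]
  | opi i => rw [frob_opi_mul, revAut_opi]
  | mul a b ha hb => rw [mul_assoc, ha, mul_assoc, hb, map_mul (revAut r), mul_assoc]
  | add a b ha hb => rw [add_mul, map_add, ha, hb, map_add, mul_add, map_add]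

theorem inv_le (v : Equiv.Perm (Fin r)) : inv v ≤ r * r := by
  simpa [inv] using Finset.card_le_univ (inversions v)

/-- A longest term `π̄_v` with `v ≠ w₀` has an ascent `i`, and multiplying by `π̄_i` makes `v s_i` a
longest term with the same coefficient. The counter `n` bounds the number of steps, since `inv v ≤ r
* r`. -/
theorem exists_frob_ne_zero_of_high (n : ℕ) : ∀ (m : Hecke r) (v : Equiv.Perm (Fin r)),
    r * r < inv v + n → (∀ u, inv v < inv u → coeff u m = 0) → coeff v m ≠ 0 →
    ∃ k, frob r (m * k) ≠ 0 := by
  induction n with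
  | zero =>
    intro m v hn
    exact absurd (inv_le v) (by omega)
  | succ n ih =>
    intro m v hn hm hv
    by_cases hd : ∀ i, Desc v i
    · exact ⟨1, by rwa [mul_one, frob, ← eq_revPerm_of_forall_desc hd]⟩
    · push Not at hd
      obtain ⟨i, hi⟩ := hd
      have h₁ := inv_mul_simpleTransposition hi
      have hdi : Desc (v * simpleTransposition i) i := desc_mul_simpleTransposition.mpr hi
      obtain ⟨k, hk⟩ := ih (m * opi i) (v * simpleTransposition i) (by omega) (by
        intro u hu
        rw [coeff_mul_opi]
        split_ifs with hdu
        · have := inv_mul_simpleTransposition_of_desc hdu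
          rw [hm u (by omega), hm _ (by omega), sub_zero]
        · rfl) (by
        rw [coeff_mul_opi, if_pos hdi, mul_simpleTransposition_cancel,
          hm (v * simpleTransposition i) (by omega), sub_zero]
        exact hv)
      exact ⟨opi i * k, by rwa [← mul_assoc]⟩

theorem exists_frob_ne_zero {m : Hecke r} (hm : m ≠ 0) : ∃ k, frob r (m * k) ≠ 0 := by
  have hne : (Finset.univ.filter fun v : Equiv.Perm (Fin r) => coeff v m ≠ 0).Nonempty := by
    by_contra hc
    rw [Finset.not_nonempty_iff_eq_empty, Finset.filter_eq_empty_iff] at hc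
    exact hm (eq_zero_of_coeff fun v => by simpa using hc (Finset.mem_univ v))
  obtain ⟨v, hv, hmax⟩ := Finset.exists_max_image _ inv hne
  refine exists_frob_ne_zero_of_high (r * r + 1) m v (by omega) (fun u hu => ?_) (by simpa using hv)
  by_contra hc
  exact not_le.mpr hu (hmax u (by simpa using hc))

theorem frob_nondegenerate {x y : Hecke r} (h : ∀ k, frob r (x * k) = frob r (y * k)) : x = y := by
  have h₀ : x + (-1 : ℂ) • y = 0 := by
    by_contra hne
    obtain ⟨k, hk⟩ := exists_frob_ne_zero hne
    rw [add_mul, smul_mul_assoc, map_add, map_smul, h k] at hk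
    simp at hk
  calc x = x + ((-1 : ℂ) • y + (1 : ℂ) • y) := by
        rw [← add_smul, neg_add_cancel, zero_smul, add_zero]
    _ = y := by rw [← add_assoc, h₀, zero_add, one_smul]

/-! ### Symmetries of the Cartan matrix -/

theorem cartan_eq_finrank_corner (α β : Composition r) :
    cartan r α β =
      Module.finrank ℂ (corner ℂ (gen (setEquiv r α)) (gen (setEquiv r β))) :=
  finrank_hom_span (groupInvertible_gen _) _

theorem finrank_corner_gen_eq_revGen (S T : Finset (Fin (r - 1))) :
    Module.finrank ℂ (corner ℂ (gen S) (gen T)) =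
      Module.finrank ℂ (corner ℂ (revGen S) (revGen T)) :=
  finrank_corner_swap (groupInvertible_gen S) (groupInvertible_gen T) (groupInvertible_revGen S)
    (groupInvertible_revGen T)

/-- `flip` carries the corner of `gen S, gen T` to that of `revGen T, revGen S`, and the swap
returns to `gen T, gen S`. -/
theorem cartan_comm (α β : Composition r) : cartan r α β = cartan r β α := by
  have key : ∀ S T : Finset (Fin (r - 1)), Module.finrank ℂ (corner ℂ (gen S) (gen T)) ≤
      Module.finrank ℂ (corner ℂ (gen T) (gen S)) := fun S T => by
    rw [finrank_corner_gen_eq_revGen T S]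
    refine finrank_corner_le (flip r) (flip r) (fun h => mem_corner.mpr ⟨flip r h, ?_⟩)
      fun h => flip_flip _
    rw [flip_mul, flip_mul, flip_gen, flip_gen, mul_assoc]
  rw [cartan_eq_finrank_corner, cartan_eq_finrank_corner]
  exact le_antisymm (key _ _) (key _ _)

theorem cartan_complement (α β : Composition r) :
    cartan r (complement α) (complement β) = cartan r α β := by
  have key : ∀ S T : Finset (Fin (r - 1)), Module.finrank ℂ (corner ℂ (gen Sᶜ) (gen Tᶜ)) ≤
      Module.finrank ℂ (corner ℂ (gen S) (gen T)) := fun S T => by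
    have h := finrank_corner_map_le (negAut r) (negAut r) negAut_negAut (gen Sᶜ) (gen Tᶜ)
    rwa [negAut_gen, negAut_gen,
      corner_smul (mul_ne_zero (longSign_ne_zero _) (longSign_ne_zero _))
        (mul_ne_zero (longSign_ne_zero _) (longSign_ne_zero _)),
      ← finrank_corner_gen_eq_revGen] at h
  rw [cartan_eq_finrank_corner, cartan_eq_finrank_corner, setEquiv_complement,
    setEquiv_complement]
  refine le_antisymm (key _ _) ?_
  have := key (setEquiv r α)ᶜ (setEquiv r β)ᶜ
  rwa [compl_compl, compl_compl] at this

theorem cartan_reverse_right (α β : Composition r) : cartan r β α.reverse = cartan r α β := by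
  have key : ∀ α β : Composition r, cartan r α β ≤ cartan r β α.reverse := fun α β => by
    rw [cartan_eq_finrank_corner, cartan_eq_finrank_corner]
    have h := finrank_corner_le_of_form (frob r) (revAut r) frob_mul
      (fun x y => frob_nondegenerate) (groupInvertible_gen (setEquiv r α))
      (groupInvertible_gen (setEquiv r β))
    obtain ⟨c, hc, e⟩ := revAut_gen (rev_mem_setEquiv_reverse α)
    have e' := corner_smul (a := gen (setEquiv r β)) (b := gen (setEquiv r α.reverse))
      one_ne_zero hc
    rw [one_smul] at e'
    rwa [e, e'] at h
  -- The inequality is cyclic of order four: `(α, β)`, `(β, αʳ)`, `(αʳ, βʳ)`, `(βʳ, α)`, and back to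
  -- `(α, β)`.
  have h₁ := key β α.reverse
  have h₂ := key α.reverse β.reverse
  have h₃ := key β.reverse α
  rw [Composition.reverse_reverse] at h₂ h₃
  refine le_antisymm ?_ (key α β)
  exact h₁.trans (h₂.trans h₃)

theorem cartan_actionHom (g : DihedralGroup 4 × Multiplicative (ZMod 2))
    (p : Composition r × Composition r) :
    cartan r (actionHom r g p).1 (actionHom r g p).2 = cartan r p.1 p.2 := by
  -- The permutations preserving the Cartan matrix form a submonoid; the action uses only natural
  -- powers and products of `ex`, `eta` and `compl`.
  let G : Submonoid (Equiv.Perm (Composition r × Composition r)) :=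
    { carrier := {s | ∀ p, cartan r (s p).1 (s p).2 = cartan r p.1 p.2}
      one_mem' := fun p => rfl
      mul_mem' := fun {s t} hs ht p => (hs (t p)).trans (ht p) }
  have hex : ex r ∈ G := fun p => cartan_comm p.2 p.1
  have hcompl : compl r ∈ G := fun p => cartan_complement p.1 p.2
  have heta : eta r ∈ G := fun p => by
    change cartan r p.2.reverse p.1 = cartan r p.1 p.2
    rw [cartan_comm, cartan_reverse_right, cartan_comm]
  obtain ⟨d, k⟩ := g
  have hd : dihedralHom r d ∈ G := by
    rcases d with i | i
    · exact pow_mem heta _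
    · exact mul_mem hex (pow_mem heta _)
  have hk : complHom r k ∈ G := pow_mem hcompl _
  exact mul_mem hd hk p

end Symmetries

end ZeroHecke

end

/-- The Cartan matrix of the 0-Hecke algebra `H_r(0)` is constant on the orbits of the action of
`D₄ × ℤ₂` on pairs of compositions of `r`. -/
theorem mainTheorem11 (r : ℕ) (p q : Composition r × Composition r)
    (h : q ∈ MulAction.orbit (DihedralGroup 4 × Multiplicative (ZMod 2)) p) :
    ZeroHecke.cartan r q.1 q.2 = ZeroHecke.cartan r p.1 p.2 := by
  obtain ⟨g, rfl⟩ := h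
  exact ZeroHecke.cartan_actionHom g p
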